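/- Let $\xi:\Omega\to\mathbb{R}^d$ be a random variable on a probability space $(\Omega,\mathcal F,\mathcal P)$, put $\Xi=\xi(\Omega)$, and let $\xi_1,\xi_2,\dots$ be an i.i.d. sample of $\xi$ with values in $\Xi$. Let $T>0$, $\delta>0$, $A\in\mathbb{R}^{n\times n}$, $B\in\mathbb{R}^{n\times m}$, $C\in\mathbb{R}^{l\times n}$, $D\in\mathbb{R}^{l\times m}$, $x_0\in\mathbb{R}^n$, $f\in L^2(0,T)^l$, $x_d\in L^2(0,T)^n$, $u_d\in L^2(0,T)^m$, and let $K\subseteq\mathbb{R}^k$ be nonempty, closed and convex. Let $F:\mathbb{R}^n\times\Xi\to\mathbb{R}$ and $g:\mathbb{R}^n\times\Xi\to\mathbb{R}^k$ be continuously differentiable in the first argument for almost every $\xi\in\Xi$ and measurable in the second argument, and let $M:\Xi\to\mathbb{R}^{n\times n}$ and $q:\Xi\to\mathbb{R}^n$ be measurable. Here $\|\cdot\|$ is the Euclidean norm of vectors and matrices, and $\|\cdot\|_1$ is the $1$-norm of vectors and the matrix norm induced by it. Assume the following. (a) There are nonnegative measurable functions $\kappa_1,\dots,\kappa_4$ on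 $\Xi$ with $\mathbb{E}[\kappa_i(\xi)]<\infty$ such that, for all $z_1,z_2\in\mathbb{R}^n$, $|F(z_1,\xi)-F(z_2,\xi)|\le\kappa_1(\xi)\|z_1-z_2\|$ and $\|g(z_1,\xi)\|\le\kappa_2(\xi)\|z_1\|$ for a.e. $\xi\in\Xi$, and $\|M(\xi)\|\le\kappa_3(\xi)$, $\|q(\xi)\|\le\kappa_4(\xi)$ for all $\xi\in\Xi$. (b) $l<m$, $D$ has full row rank, and, with $D^\dagger=D^\top(DD^\top)^{-1}$ and $Y\in\mathbb{R}^{m\times(m-l)}$ a matrix of full column rank with $DY=0$, the matrix $[BY,\ (A-BD^\dagger C)BY,\ \dots,\ (A-BD^\dagger C)^{n-1}BY]$ has full row rank $n$. (c) $\{w\in\mathbb{R}^k:\|w\|\le\beta\,\mathbb{E}[\kappa_2(\xi)]\,\|\mathbb{E}[q(\xi)]\|_1\}\subseteq K$, where $\beta$ is the maximum of $\|(\mathbb{E}[M_{J,J}(\xi)])^{-1}\|_1$ over all nonempty $J\subseteq\{1,\dots,n\}$ for which the principal submatrix $\mathbb{E}[M_{J,J}(\xi)]$ is nonsingular, and $\beta=1$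 if there is no such $J$. (d) There is $v\ge0$ in $\mathbb{R}^n$ with $\mathbb{E}[M(\xi)v+q(\xi)]\ge0$. (e) $\bar M:=\mathbb{E}[M(\xi)]$ is a Z-matrix (its off-diagonal entries are non-positive) or an adequate matrix (for $N=\bar M$ and for $N=\bar M^\top$: whenever $z\in\mathbb{R}^n$ satisfies $z_i(Nz)_i\le0$ for all $i$, then $Nz=0$). Then for every $\epsilon>0$, with probability $1$, for all sufficiently large $\nu$ (how large may depend on $\epsilon$ and on the realization of the sample), the relaxed sample average approximation problem \begin{align*} \min_{x,u}\quad &\frac1\nu\sum_{j=1}^\nu F(x(T),\xi_j)+\frac12\|x-x_d\|_{L^2}^2+\frac\delta2\|u-u_d\|_{L^2}^2\\ \text{s.t.}\quad &\dot x(t)=Ax(t)+Bu(t),\quad Cx(t)+Du(t)-f(t)\le0\quad\text{for a.e. }t\in(0,T),\\ &\Big\|\min\Big\{x(T),\ \frac1\nu\sum_{j=1}^\nu[M(\xi_j)x(T)+q(\xi_j)]\Big\}\Big\|\le\epsilon,\\ &x(0)=x_0,\qquad \frac1\nu\sum_{j=1}^\nu g(x(T),\xi_j)\in K^\epsilon:=\{w\in\mathbb{R}^k:\operatorname{dist}(w,K)\le\epsilon\}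 \end{align*} has an optimal solution $(x,u)\in H^1(0,T)^n\times L^2(0,T)^m$, the minimum in the residual constraint being taken componentwise. -/

import Mathlib

open MeasureTheory ProbabilityTheory Filter
open scoped Matrix

namespace SAAControl

/-- `ℝⁿ` with the Euclidean norm. -/
abbrev Vec (n : ℕ) := EuclideanSpace ℝ (Fin n)

/-! ### Function spaces on `(0,T)` -/

/-- Lebesgue measure on `(0,T)`. -/
noncomputable abbrev timeMeasure (T : ℝ) : Measure ℝ := volume.restrict (Set.Ioo 0 T)

/-- `L²(0,T)ⁿ`; its norm is `(∫₀ᵀ ‖x(t)‖² dt)^{1/2}`. -/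
noncomputable abbrev L2 (T : ℝ) (n : ℕ) := Lp (Vec n) 2 (timeMeasure T)

/-- `v` is the weak derivative of `x` on `(0,T)`. -/
def IsWeakDeriv {T : ℝ} {n : ℕ} (x v : L2 T n) : Prop :=
  ∀ φ : ℝ → ℝ, ContDiff ℝ ((⊤ : ℕ∞) : WithTop ℕ∞) φ → HasCompactSupport φ → tsupport φ ⊆ Set.Ioo 0 T →
    ∫ t in Set.Ioo 0 T, deriv φ t • x t = - ∫ t in Set.Ioo 0 T, φ t • v t

/-- `H¹(0,T)ⁿ`: an element of `L²(0,T)ⁿ` together with its weak derivative in `L²(0,T)ⁿ`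
(the weak derivative is unique, so that it carries no extra information). -/
structure H1 (T : ℝ) (n : ℕ) where
  fn : L2 T n
  dot : L2 T n
  isWeakDeriv : IsWeakDeriv fn dot

/-- `c` is a representative of `x` that is continuous on `[0,T]`. -/
def IsContRep {T : ℝ} {n : ℕ} (x : L2 T n) (c : ℝ → Vec n) : Prop :=
  ContinuousOn c (Set.Icc 0 T) ∧ ∀ᵐ t ∂(timeMeasure T), x t = c t

open Classical in
/-- The pointwise values on `[0,T]` of `x ∈ H¹(0,T)ⁿ`, in particular `x(0)` and `x(T)`: those of
its continuous representative (every element of `H¹(0,T)ⁿ` has one, and only one, so that the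
`else` branch is never reached for `T > 0`). -/
noncomputable def H1.eval {T : ℝ} {n : ℕ} (x : H1 T n) : ℝ → Vec n :=
  if h : ∃ c, IsContRep x.fn c then h.choose else 0

/-- The value at a point of `[0,T]` does not depend on the chosen continuous representative. -/
theorem H1.eval_eq {T : ℝ} {n : ℕ} (hT : 0 < T) (x : H1 T n) {c : ℝ → Vec n}
    (hc : IsContRep x.fn c) {t : ℝ} (ht : t ∈ Set.Icc 0 T) : x.eval t = c t := by
  have h : ∃ c, IsContRep x.fn c := ⟨c, hc⟩
  have he : x.eval = h.choose := by simp only [H1.eval, dif_pos h]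
  have hs := h.choose_spec
  rw [he]
  refine Measure.eqOn_Icc_of_ae_eq volume hT.ne ?_ hs.1 hc.1 ht
  rw [← restrict_Ioo_eq_restrict_Icc]
  filter_upwards [hs.2, hc.2] with s h1 h2
  rw [← h1, h2]

/-! ### Matrices -/

/-- The `1`-norm of a vector. -/
noncomputable def vecOneNorm {n : ℕ} (v : Vec n) : ℝ := ∑ i, |v i|

/-- The matrix norm induced by the vector `1`-norm: the largest absolute column sum. -/
noncomputable def matOneNorm {ι : Type*} [Fintype ι] (A : Matrix ι ι ℝ) : ℝ :=
  ⨆ j, ∑ i, |A i j|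

/-- The Euclidean (Frobenius) norm of a matrix. -/
noncomputable def matNorm {n : ℕ} (A : Matrix (Fin n) (Fin n) ℝ) : ℝ :=
  Real.sqrt (∑ i, ∑ j, A i j ^ 2)

/-- All off-diagonal entries are non-positive. -/
def IsZMatrix {n : ℕ} (A : Matrix (Fin n) (Fin n) ℝ) : Prop :=
  ∀ i j, i ≠ j → A i j ≤ 0

def IsColumnAdequate {n : ℕ} (A : Matrix (Fin n) (Fin n) ℝ) : Prop :=
  ∀ z : Fin n → ℝ, (∀ i, z i * (A *ᵥ z) i ≤ 0) → A *ᵥ z = 0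

/-- Column adequate and row adequate. -/
def IsAdequate {n : ℕ} (A : Matrix (Fin n) (Fin n) ℝ) : Prop :=
  IsColumnAdequate A ∧ IsColumnAdequate Aᵀ

/-- The principal submatrix `A_{J,J}`. -/
def principal {n : ℕ} (A : Matrix (Fin n) (Fin n) ℝ) (J : Finset (Fin n)) :
    Matrix J J ℝ :=
  A.submatrix (fun i => (i : Fin n)) (fun j => (j : Fin n))

open Classical in
/-- The nonempty index sets `J` for which `A_{J,J}` is nonsingular. -/
noncomputable def nonsingularSets {n : ℕ} (A : Matrix (Fin n) (Fin n) ℝ) :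
    Finset (Finset (Fin n)) :=
  Finset.univ.filter fun J => J.Nonempty ∧ (principal A J).det ≠ 0

open Classical in
/-- The largest `‖(A_{J,J})⁻¹‖₁` over the nonempty `J` with `A_{J,J}` nonsingular, and `1` if there
is no such `J`. -/
noncomputable def beta {n : ℕ} (A : Matrix (Fin n) (Fin n) ℝ) : ℝ :=
  if h : (nonsingularSets A).Nonempty then
    (nonsingularSets A).sup' h fun J => matOneNorm (principal A J)⁻¹
  else 1

/-- The pseudoinverse `Dᵀ (D Dᵀ)⁻¹` of a matrix `D` of full row rank. -/
noncomputable def pinv {l m : ℕ} (D : Matrix (Fin l) (Fin m) ℝ) : Matrix (Fin m) (Fin l) ℝ :=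
  Dᵀ * (D * Dᵀ)⁻¹

/-! ### The optimal control problem -/

/-- The data of the problem: horizon `T`, state, control, path-constraint and terminal-constraint
dimensions `n`, `m`, `l`, `k`, random parameter in `Ξ`. -/
structure Data (Ξ : Type*) (T : ℝ) (n m l k : ℕ) where
  A : Matrix (Fin n) (Fin n) ℝ
  B : Matrix (Fin n) (Fin m) ℝ
  C : Matrix (Fin l) (Fin n) ℝ
  D : Matrix (Fin l) (Fin m) ℝ
  x₀ : Vec n
  f : L2 T l
  xd : L2 T n
  ud : L2 T m
  δ : ℝ
  K : Set (Vec k)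
  F : Vec n → Ξ → ℝ
  g : Vec n → Ξ → Vec k
  M : Ξ → Matrix (Fin n) (Fin n) ℝ
  q : Ξ → Vec n

section Assumptions

variable {Ω Ξ : Type*} [MeasurableSpace Ω] [MeasurableSpace Ξ] {T : ℝ} {n m l k : ℕ}

/-- The setting of the problem; `X` is the random parameter, with law `P.map X` on `Ξ`. -/
structure Data.IsStandard (p : Data Ξ T n m l k) (X : Ω → Ξ) (P : Measure Ω) : Prop where
  T_pos : 0 < T
  δ_pos : 0 < p.δ
  K_nonempty : p.K.Nonempty
  K_closed : IsClosed p.K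
  K_convex : Convex ℝ p.K
  F_contDiff : ∀ᵐ y ∂(P.map X), ContDiff ℝ 1 fun z => p.F z y
  F_measurable : ∀ z, Measurable (p.F z)
  g_contDiff : ∀ᵐ y ∂(P.map X), ContDiff ℝ 1 fun z => p.g z y
  g_measurable : ∀ z, Measurable (p.g z)
  M_measurable : ∀ i j, Measurable fun y => p.M y i j
  q_measurable : Measurable p.q

/-- Lipschitz and growth bounds with integrable moduli `κ₁, …, κ₄`. -/
structure Data.GrowthAssumption (p : Data Ξ T n m l k) (X : Ω → Ξ) (P : Measure Ω)
    (κ₁ κ₂ κ₃ κ₄ : Ξ → ℝ) : Prop where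
  measurable : Measurable κ₁ ∧ Measurable κ₂ ∧ Measurable κ₃ ∧ Measurable κ₄
  nonneg : ∀ y, 0 ≤ κ₁ y ∧ 0 ≤ κ₂ y ∧ 0 ≤ κ₃ y ∧ 0 ≤ κ₄ y
  integrable : Integrable (fun ω => κ₁ (X ω)) P ∧ Integrable (fun ω => κ₂ (X ω)) P ∧
    Integrable (fun ω => κ₃ (X ω)) P ∧ Integrable (fun ω => κ₄ (X ω)) P
  F_lipschitz : ∀ z₁ z₂, ∀ᵐ y ∂(P.map X), |p.F z₁ y - p.F z₂ y| ≤ κ₁ y * ‖z₁ - z₂‖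
  g_growth : ∀ z, ∀ᵐ y ∂(P.map X), ‖p.g z y‖ ≤ κ₂ y * ‖z‖
  M_bound : ∀ y, matNorm (p.M y) ≤ κ₃ y
  q_bound : ∀ y, ‖p.q y‖ ≤ κ₄ y

/-- The block matrix `[BY, (A - B D† C) B Y, …, (A - B D† C)ⁿ⁻¹ B Y]`. -/
noncomputable def Data.controlMatrix (p : Data Ξ T n m l k)
    (Y : Matrix (Fin m) (Fin (m - l)) ℝ) : Matrix (Fin n) (Fin n × Fin (m - l)) ℝ :=
  Matrix.of fun i c => ((p.A - p.B * pinv p.D * p.C) ^ (c.1 : ℕ) * p.B * Y) i c.2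

/-- `D` has full row rank `l < m` and, for `Y` with full column rank `m - l` and `D Y = 0`,
the controllability matrix has full row rank. -/
def Data.ControlAssumption (p : Data Ξ T n m l k) : Prop :=
  l < m ∧ p.D.rank = l ∧ ∃ Y : Matrix (Fin m) (Fin (m - l)) ℝ,
    Y.rank = m - l ∧ p.D * Y = 0 ∧ (p.controlMatrix Y).rank = n

/-- `𝔼[M(ξ)]`. -/
noncomputable def Data.meanM (p : Data Ξ T n m l k) (X : Ω → Ξ) (P : Measure Ω) :
    Matrix (Fin n) (Fin n) ℝ :=
  Matrix.of fun i j => ∫ ω, p.M (X ω) i j ∂P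

/-- `𝔼[q(ξ)]`. -/
noncomputable def Data.meanq (p : Data Ξ T n m l k) (X : Ω → Ξ) (P : Measure Ω) : Vec n :=
  ∫ ω, p.q (X ω) ∂P

/-- `𝒱 = {v ≥ 0 | 𝔼[M(ξ) v + q(ξ)] ≥ 0}`. -/
def Data.feasibleLCP (p : Data Ξ T n m l k) (X : Ω → Ξ) (P : Measure Ω) : Set (Vec n) :=
  {v | (∀ i, 0 ≤ ∫ ω, ((p.M (X ω) *ᵥ v.ofLp) i + p.q (X ω) i) ∂P) ∧ ∀ i, 0 ≤ v i}

end Assumptions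

section SAA

variable {Ξ : Type*} {T : ℝ} {n m l k : ℕ}

/-- The sample average `(1/ν) ∑ h(ξ_ℓ)` over the first `ν` members of the sample `s`. -/
noncomputable def sampleMean {V : Type*} [AddCommGroup V] [Module ℝ V] (s : ℕ → Ξ) (ν : ℕ)
    (h : Ξ → V) : V :=
  (1 / (ν : ℝ)) • ∑ i ∈ Finset.range ν, h (s i)

/-- The SAA objective `Φ^ν`. -/
noncomputable def Data.saaObjective (p : Data Ξ T n m l k) (s : ℕ → Ξ) (ν : ℕ)
    (z : H1 T n × L2 T m) : ℝ :=
  sampleMean s ν (fun y => p.F (z.1.eval T) y) + 1 / 2 * ‖z.1.fn - p.xd‖ ^ 2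
    + p.δ / 2 * ‖z.2 - p.ud‖ ^ 2

/-- `min {b, (1/ν) ∑ [M(ξ_ℓ) b + q(ξ_ℓ)]}`, componentwise. -/
noncomputable def Data.saaMin (p : Data Ξ T n m l k) (s : ℕ → Ξ) (ν : ℕ) (b : Vec n) : Vec n :=
  WithLp.toLp 2 fun i =>
    min (b i) (sampleMean s ν (fun y => (p.M y *ᵥ b.ofLp) i + p.q y i))

/-- Feasible pairs `(x,u) ∈ H¹(0,T)ⁿ × L²(0,T)ᵐ` of the relaxed SAA problem with sample `s`,
sample size `ν` and tolerance `ε`. -/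
structure Data.IsSAAFeasible (p : Data Ξ T n m l k) (s : ℕ → Ξ) (ν : ℕ) (ε : ℝ)
    (z : H1 T n × L2 T m) : Prop where
  dynamics : ∀ᵐ t ∂(timeMeasure T),
    (z.1.dot t).ofLp = p.A *ᵥ (z.1.fn t).ofLp + p.B *ᵥ (z.2 t).ofLp
  path : ∀ᵐ t ∂(timeMeasure T), ∀ i,
    (p.C *ᵥ (z.1.fn t).ofLp) i + (p.D *ᵥ (z.2 t).ofLp) i - p.f t i ≤ 0
  residual : ‖p.saaMin s ν (z.1.eval T)‖ ≤ ε
  initial : z.1.eval 0 = p.x₀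
  terminal : sampleMean s ν (fun y => p.g (z.1.eval T) y) ∈ {w | Metric.infDist w p.K ≤ ε}

/-- Optimal solutions of the relaxed SAA problem. -/
def Data.IsSAAOptimal (p : Data Ξ T n m l k) (s : ℕ → Ξ) (ν : ℕ) (ε : ℝ)
    (z : H1 T n × L2 T m) : Prop :=
  p.IsSAAFeasible s ν ε z ∧
    ∀ z', p.IsSAAFeasible s ν ε z' → p.saaObjective s ν z ≤ p.saaObjective s ν z'

end SAA

end SAAControl

/-! The sampled problem is settled in two independent moves: find one terminal state that is
feasible for all large `ν`, then minimize by the direct method.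

Terminal state. Under the feedback `u = D†(f - C x) + Y w` the path constraint holds with equality
and the dynamics become a linear system with matrix `A - B D† C` and input matrix `B Y`,
controllable by the rank condition. Hence every `b ∈ ℝⁿ` is reachable (`Data.exists_steering`), and
only the residual and `g`-constraints restrict `b`. Take `b` solving the expected complementarity
problem with `‖b‖₁ ≤ beta * ‖𝔼 q‖₁` (`exists_lcp_solution_le`); the growth of `g` and the ball
contained in `K` give `𝔼 g(b) ∈ K`. The law of large numbers at this single point sends the sampled
residual and the distance to `K` to zero, so the tolerance `ε` is eventually met. No uniform law is
needed.

The bound on `b` comes from basic solutions, whose support carries a nonsingular principal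
submatrix. For a Z-matrix, a feasible point of least coordinate sum is basic. For an adequate
matrix, `q` is perturbed to be strictly feasible, a central path is followed to a solution, the
solution is reduced to a basic one, and the perturbation is removed by compactness.

Minimization. The tracking cost is uniformly convex in `(x, u)`, while the sampled `F` and the
nonconvex constraints depend only on the terminal state, a finite-dimensional affine image of `(x,
u)`. Terminal states of a minimizing sequence subconverge; near the limiting terminal state,
almost-minimizers of the convex part form a norm Cauchy sequence
(`exists_mem_le_of_uniformlyConvex`). -/

namespace SAAControl

open scoped Topology

/-! ### The linear complementarity problem -/

/-- `z` solves the linear complementarity problem with data `M`, `q`. -/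
structure IsLCPSolution {n : ℕ} (M : Matrix (Fin n) (Fin n) ℝ) (q z : Fin n → ℝ) : Prop where
  nonneg : ∀ i, 0 ≤ z i
  slack_nonneg : ∀ i, 0 ≤ (M *ᵥ z) i + q i
  compl : ∀ i, z i * ((M *ᵥ z) i + q i) = 0

/-- Sign conditions are closed, and complementarity is required only in the limit. This serves both
the central path, where the products equal `μ`, and solutions for perturbed `q`. -/
theorem IsLCPSolution.of_tendsto {n : ℕ} {M : Matrix (Fin n) (Fin n) ℝ} {q z : Fin n → ℝ}
    {qs zs : ℕ → Fin n → ℝ} (hq : Tendsto qs atTop (𝓝 q)) (hz : Tendsto zs atTop (𝓝 z))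
    (h0 : ∀ k i, 0 ≤ zs k i) (h1 : ∀ k i, 0 ≤ (M *ᵥ zs k) i + qs k i)
    (h2 : ∀ i, Tendsto (fun k => zs k i * ((M *ᵥ zs k) i + qs k i)) atTop (𝓝 0)) :
    IsLCPSolution M q z := by
  have hc : Continuous fun x : Fin n → ℝ => M *ᵥ x := by fun_prop
  have hz' := fun i => (tendsto_pi_nhds.1 hz) i
  have hw : ∀ i, Tendsto (fun k => (M *ᵥ zs k) i + qs k i) atTop (𝓝 ((M *ᵥ z) i + q i)) :=
    fun i => ((tendsto_pi_nhds.1 ((hc.tendsto z).comp hz)) i).add ((tendsto_pi_nhds.1 hq) i)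
  exact ⟨fun i => ge_of_tendsto' (hz' i) fun k => h0 k i,
    fun i => ge_of_tendsto' (hw i) fun k => h1 k i,
    fun i => tendsto_nhds_unique ((hz' i).mul (hw i)) (h2 i)⟩

theorem principal_mulVec {n : ℕ} (M : Matrix (Fin n) (Fin n) ℝ) (J : Finset (Fin n))
    (x : Fin n → ℝ) (hx : ∀ i ∉ J, x i = 0) (i : J) :
    (principal M J *ᵥ fun j : J => x j) i = (M *ᵥ x) i := by
  simp only [Matrix.mulVec, dotProduct, principal, Matrix.submatrix_apply]
  rw [Finset.sum_coe_sort J (fun j => M i j * x j)]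
  exact Finset.sum_subset (Finset.subset_univ J) fun j _ hj => by simp [hx j hj]

/-- The sign is normalized so that some entry is negative: moving along `x` from a nonnegative
vector then decreases a coordinate of the support. -/
theorem exists_principal_kernel {n : ℕ} {M : Matrix (Fin n) (Fin n) ℝ} {J : Finset (Fin n)}
    (h : (principal M J).det = 0) :
    ∃ x : Fin n → ℝ, (∀ i ∉ J, x i = 0) ∧ (∀ i ∈ J, (M *ᵥ x) i = 0) ∧ ∃ i ∈ J, x i < 0 := by
  classical
  obtain ⟨y, hy0, hy⟩ := Matrix.exists_mulVec_eq_zero_iff.2 h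
  have key : ∀ y : J → ℝ, principal M J *ᵥ y = 0 → (∃ i, y i < 0) →
      ∃ x : Fin n → ℝ, (∀ i ∉ J, x i = 0) ∧ (∀ i ∈ J, (M *ᵥ x) i = 0) ∧ ∃ i ∈ J, x i < 0 := by
    intro y hy ⟨i, hi⟩
    let x : Fin n → ℝ := fun j => if h : j ∈ J then y ⟨j, h⟩ else 0
    have hx : ∀ i ∉ J, x i = 0 := fun i hi => by simp [x, hi]
    have hxy : (fun j : J => x j) = y := by ext j; simp [x]
    refine ⟨x, hx, fun j hj => ?_, i, i.2, by simpa [x] using hi⟩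
    have := principal_mulVec M J x hx ⟨j, hj⟩
    rw [hxy, hy] at this
    exact this.symm
  obtain ⟨i, hi⟩ := Function.ne_iff.1 hy0
  rcases lt_or_gt_of_ne hi with h | h
  · exact key y hy ⟨i, h⟩
  · exact key (-y) (by rw [Matrix.mulVec_neg, hy, neg_zero]) ⟨i, by simpa using h⟩

theorem matOneNorm_nonneg {ι : Type*} [Fintype ι] (A : Matrix ι ι ℝ) : 0 ≤ matOneNorm A :=
  Real.iSup_nonneg fun _ => Finset.sum_nonneg fun _ _ => abs_nonneg _

theorem sum_abs_mulVec_le {ι : Type*} [Fintype ι] (A : Matrix ι ι ℝ) (x : ι → ℝ) :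
    ∑ i, |(A *ᵥ x) i| ≤ matOneNorm A * ∑ i, |x i| := by
  calc ∑ i, |(A *ᵥ x) i| ≤ ∑ i, ∑ j, |A i j| * |x j| := by
        refine Finset.sum_le_sum fun i _ => ?_
        refine (Finset.abs_sum_le_sum_abs _ _).trans (le_of_eq ?_)
        simp [abs_mul]
    _ = ∑ j, (∑ i, |A i j|) * |x j| := by
        rw [Finset.sum_comm]; simp [Finset.sum_mul]
    _ ≤ ∑ j, matOneNorm A * |x j| := by
        refine Finset.sum_le_sum fun j _ => mul_le_mul_of_nonneg_right ?_ (abs_nonneg _)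
        exact le_ciSup (f := fun j => ∑ i, |A i j|) (Set.finite_range _).bddAbove j
    _ = _ := by rw [Finset.mul_sum]

theorem beta_nonneg {n : ℕ} (M : Matrix (Fin n) (Fin n) ℝ) : 0 ≤ beta M := by
  unfold beta
  split_ifs with h
  · obtain ⟨J, hJ⟩ := h
    exact (matOneNorm_nonneg _).trans
      (Finset.le_sup' (f := fun J => matOneNorm (principal M J)⁻¹) hJ)
  · exact zero_le_one

open Classical in
/-- The support of a vector as a finset. -/
noncomputable def supp {n : ℕ} (z : Fin n → ℝ) : Finset (Fin n) :=
  Finset.univ.filter fun i => z i ≠ 0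

theorem mem_supp {n : ℕ} {z : Fin n → ℝ} {i : Fin n} : i ∈ supp z ↔ z i ≠ 0 := by
  simp [supp]

theorem notMem_supp {n : ℕ} {z : Fin n → ℝ} {i : Fin n} : i ∉ supp z ↔ z i = 0 := by
  simp [supp]

/-- A solution whose support gives a nonsingular principal submatrix is bounded by `beta`. -/
theorem IsLCPSolution.sum_abs_le {n : ℕ} {M : Matrix (Fin n) (Fin n) ℝ} {q z : Fin n → ℝ}
    (hz : IsLCPSolution M q z) (hdet : (principal M (supp z)).det ≠ 0) :
    ∑ i, |z i| ≤ beta M * ∑ i, |q i| := by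
  classical
  -- The empty index set does not enter `beta`; there `z = 0` and `beta_nonneg` suffices.
  rcases (supp z).eq_empty_or_nonempty with h | h
  · have : ∀ i, z i = 0 := fun i => notMem_supp.1 (by simp [h])
    simp only [this, abs_zero, Finset.sum_const_zero]
    exact mul_nonneg (beta_nonneg M) (Finset.sum_nonneg fun _ _ => abs_nonneg _)
  set J := supp z with hJ
  have hmem : J ∈ nonsingularSets M := by simp [nonsingularSets, h, hdet]
  have hle : matOneNorm (principal M J)⁻¹ ≤ beta M := by
    unfold beta
    rw [dif_pos ⟨J, hmem⟩]
    exact Finset.le_sup' (f := fun J => matOneNorm (principal M J)⁻¹) hmem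
  have hout : ∀ i ∉ J, z i = 0 := fun i hi => notMem_supp.1 hi
  -- On the support the slack vanishes, so the restriction of `z` solves a square system.
  have heq : principal M J *ᵥ (fun j : J => z j) = fun j : J => - q j := by
    ext i
    rw [principal_mulVec M J z hout i]
    have := (mul_eq_zero.1 (hz.compl i)).resolve_left (mem_supp.1 i.2)
    linarith
  have hinv : (fun j : J => z j) = (principal M J)⁻¹ *ᵥ fun j : J => - q j := by
    rw [← heq, Matrix.mulVec_mulVec, Matrix.nonsing_inv_mul _ (Ne.isUnit hdet), Matrix.one_mulVec]
  have h1 : ∑ i, |z i| = ∑ i : J, |z i| := by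
    rw [Finset.sum_coe_sort J (fun j => |z j|)]
    exact (Finset.sum_subset (Finset.subset_univ J) fun j _ hj => by simp [hout j hj]).symm
  have h2 : ∑ i : J, |q i| ≤ ∑ i, |q i| := by
    rw [Finset.sum_coe_sort J (fun j => |q j|)]
    exact Finset.sum_le_sum_of_subset_of_nonneg (Finset.subset_univ J) fun _ _ _ => abs_nonneg _
  calc ∑ i, |z i| = ∑ i : J, |((principal M J)⁻¹ *ᵥ fun j : J => - q j) i| := by
        rw [h1, ← hinv]
    _ ≤ matOneNorm (principal M J)⁻¹ * ∑ i : J, |- q i| := sum_abs_mulVec_le _ _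
    _ ≤ beta M * ∑ i, |q i| := by
        simp only [abs_neg]
        exact mul_le_mul hle h2 (Finset.sum_nonneg fun _ _ => abs_nonneg _) (beta_nonneg M)

theorem mulVec_add_smul {n : ℕ} (M : Matrix (Fin n) (Fin n) ℝ) (z d : Fin n → ℝ) (t : ℝ)
    (i : Fin n) : (M *ᵥ (z + t • d)) i = (M *ᵥ z) i + t * (M *ᵥ d) i := by
  simp [Matrix.mulVec_add, Matrix.mulVec_smul]

/-- Column adequate matrices: every solvable problem has a basic solution. -/
theorem IsColumnAdequate.exists_basic {n : ℕ} {M : Matrix (Fin n) (Fin n) ℝ}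
    (hM : IsColumnAdequate M) {q z : Fin n → ℝ} (hz : IsLCPSolution M q z) :
    ∃ z', IsLCPSolution M q z' ∧ (principal M (supp z')).det ≠ 0 := by
  -- While the principal submatrix of the support is singular, moving along a kernel vector shrinks
  -- the support and keeps a solution.
  induction hk : (supp z).card using Nat.strong_induction_on generalizing z with
  | _ k ih =>
    by_cases hdet : (principal M (supp z)).det ≠ 0
    · exact ⟨z, hz, hdet⟩
    push Not at hdet
    obtain ⟨d, hd0, hd1, i₀, hi₀, hi₀'⟩ := exists_principal_kernel hdet
    -- `d` vanishes off the support and `M d` on it, so all products are zero and adequacy gives `M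
    -- d = 0`; the slack is constant along `d`.
    have hMd : M *ᵥ d = 0 := by
      refine hM d fun i => le_of_eq ?_
      by_cases hi : i ∈ supp z
      · rw [hd1 i hi, mul_zero]
      · rw [hd0 i hi, zero_mul]
    -- Ratio test: `t` is the largest step keeping `z + t • d` nonnegative, and coordinate `j`
    -- reaches zero.
    obtain ⟨j, hj, hmin⟩ := Finset.exists_min_image (Finset.univ.filter fun i => d i < 0)
      (fun i => z i / (- d i)) ⟨i₀, by simpa using hi₀'⟩
    simp only [Finset.mem_filter, Finset.mem_univ, true_and] at hj hmin
    set t := z j / (- d j) with ht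
    have ht0 : 0 ≤ t := div_nonneg (hz.nonneg j) (by linarith)
    have hzero : (z + t • d) j = 0 := by
      have : d j ≠ 0 := hj.ne
      simp only [Pi.add_apply, Pi.smul_apply, smul_eq_mul, ht]
      field_simp
      ring
    have hsol : IsLCPSolution M q (z + t • d) := by
      have hw : ∀ i, (M *ᵥ (z + t • d)) i = (M *ᵥ z) i := fun i => by
        rw [mulVec_add_smul, hMd]; simp
      refine ⟨fun i => ?_, fun i => by rw [hw]; exact hz.slack_nonneg i, fun i => ?_⟩
      · simp only [Pi.add_apply, Pi.smul_apply, smul_eq_mul]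
        rcases lt_or_ge (d i) 0 with h | h
        · have := hmin i h
          rw [le_div_iff₀ (by linarith)] at this
          linarith
        · have := hz.nonneg i
          positivity
      · rw [hw]
        by_cases hi : i ∈ supp z
        · rw [(mul_eq_zero.1 (hz.compl i)).resolve_left (mem_supp.1 hi), mul_zero]
        · simp [hd0 i hi, notMem_supp.1 hi]
    refine ih _ ?_ hsol rfl
    rw [← hk]
    refine Finset.card_lt_card (Finset.ssubset_iff_subset_ne.2 ⟨fun i hi => ?_, fun h => ?_⟩)
    · by_contra hi'
      exact mem_supp.1 hi (by simp [hd0 i hi', notMem_supp.1 hi'])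
    · have : j ∈ supp z := by
        by_contra hj'
        exact hj.ne (hd0 j hj')
      rw [← h] at this
      exact mem_supp.1 this hzero

/-! ### `Z`-matrices -/

theorem isClosed_forall_nonneg {E ι : Type*} [TopologicalSpace E] {f : ι → E → ℝ}
    (hf : ∀ i, Continuous (f i)) : IsClosed {x | ∀ i, 0 ≤ f i x} := by
  rw [Set.ofPred_forall]
  exact isClosed_iInter fun i => isClosed_le continuous_const (hf i)

/-- A feasible point of least coordinate sum is minimal in the componentwise order. For a Z-matrix,
lowering the coordinates other than `i` can only raise row `i` of `M z`; so a violation of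
complementarity, or a kernel vector on the support, would yield a smaller feasible point. -/
theorem IsZMatrix.exists_basic {n : ℕ} {M : Matrix (Fin n) (Fin n) ℝ}
    (hM : IsZMatrix M) {q v : Fin n → ℝ} (hv : ∀ i, 0 ≤ v i)
    (hv' : ∀ i, 0 ≤ (M *ᵥ v) i + q i) :
    ∃ z, IsLCPSolution M q z ∧ (principal M (supp z)).det ≠ 0 := by
  classical
  let S : Set (Fin n → ℝ) := {z | (∀ i, 0 ≤ z i) ∧ (∀ i, 0 ≤ (M *ᵥ z) i + q i)}
  -- Truncation at the level of `v` gives compactness without changing the minimum.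
  let S' : Set (Fin n → ℝ) := S ∩ {z | ∑ i, z i ≤ ∑ i, v i}
  have hclosed : IsClosed S' := by
    refine (IsClosed.inter ?_ ?_).inter (isClosed_le (by fun_prop) continuous_const)
    · exact isClosed_forall_nonneg fun i => by fun_prop
    · exact isClosed_forall_nonneg fun i => by fun_prop
  have hcomp : IsCompact S' := by
    refine (isCompact_Icc (a := (0 : Fin n → ℝ)) (b := fun _ => ∑ i, v i)).of_isClosed_subset
      hclosed fun z hz => ⟨fun i => hz.1.1 i, fun i => ?_⟩
    exact (Finset.single_le_sum (fun j _ => hz.1.1 j) (Finset.mem_univ i)).trans hz.2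
  obtain ⟨z, hz, hzmin⟩ := hcomp.exists_isMinOn (f := fun z => ∑ i, z i)
    ⟨v, ⟨hv, hv'⟩, le_refl (∑ i, v i)⟩ (by fun_prop)
  have hleast : ∀ y ∈ S, y ≤ z → y = z := by
    intro y hy hyz
    have h1 : ∑ i, y i ≤ ∑ i, z i := Finset.sum_le_sum fun i _ => hyz i
    have h2 : ∑ i, z i ≤ ∑ i, y i := hzmin (show y ∈ S' from ⟨hy, h1.trans hz.2⟩)
    have := (Finset.sum_eq_sum_iff_of_le fun i _ => hyz i).1 (le_antisymm h1 h2)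
    exact funext fun i => this i (Finset.mem_univ i)
  have hmono : ∀ {x y : Fin n → ℝ} {i}, y ≤ x → y i = x i → (M *ᵥ x) i ≤ (M *ᵥ y) i := by
    intro x y i hyx hi
    simp only [Matrix.mulVec, dotProduct]
    refine Finset.sum_le_sum fun j _ => ?_
    by_cases hij : i = j
    · subst hij; rw [hi]
    · nlinarith [hM i j hij, hyx j]
  have hcompl : ∀ i, z i * ((M *ᵥ z) i + q i) = 0 := by
    intro i
    by_contra hne
    have hzi : 0 < z i := lt_of_le_of_ne (hz.1.1 i) fun h => hne (by rw [← h, zero_mul])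
    have hwi : 0 < (M *ᵥ z) i + q i :=
      lt_of_le_of_ne (hz.1.2 i) fun h => hne (by rw [← h, mul_zero])
    -- Lowering coordinate `i` by `t` costs row `i` at most its slack; the other rows do not
    -- decrease, their entries in column `i` being nonpositive.
    obtain ⟨t, ht, ht1, ht2⟩ : ∃ t : ℝ, 0 < t ∧ t ≤ z i ∧ t * |M i i| ≤ (M *ᵥ z) i + q i := by
      refine ⟨min (z i) (((M *ᵥ z) i + q i) / (|M i i| + 1)), ?_, min_le_left _ _, ?_⟩
      · positivity
      · have h1 := min_le_right (z i) (((M *ᵥ z) i + q i) / (|M i i| + 1))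
        rw [le_div_iff₀ (by positivity)] at h1
        have h2 : 0 ≤ min (z i) (((M *ᵥ z) i + q i) / (|M i i| + 1)) := by positivity
        nlinarith
    have hM1 : ∀ j, (M *ᵥ (Pi.single i 1 : Fin n → ℝ)) j = M j i := by
      intro j; simp
    have := hleast (z + (-t) • Pi.single i 1) ?_ ?_
    · have := congrFun this i
      simp at this
      exact ht.ne' this
    · refine ⟨fun j => ?_, fun j => ?_⟩
      · by_cases hij : j = i
        · subst hij; simp; linarith
        · simpa [hij] using hz.1.1 j
      · rw [mulVec_add_smul, hM1]
        by_cases hij : j = i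
        · subst hij
          nlinarith [le_abs_self (M j j)]
        · nlinarith [hM j i hij, hz.1.2 j]
    · intro j
      by_cases hij : j = i
      · subst hij; simp; linarith
      · simp [hij]
  refine ⟨z, ⟨hz.1.1, hz.1.2, hcompl⟩, fun hdet => ?_⟩
  obtain ⟨d, hd0, hd1, i₀, hi₀, hi₀'⟩ := exists_principal_kernel hdet
  have hpos : ∀ i ∈ supp z, 0 < z i := fun i hi =>
    lt_of_le_of_ne (hz.1.1 i) (mem_supp.1 hi).symm
  obtain ⟨t, ht, ht'⟩ : ∃ t : ℝ, 0 < t ∧ ∀ i, 0 ≤ z i + t * d i := by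
    have h : ∀ i, ∀ᶠ t in 𝓝[>] (0 : ℝ), 0 ≤ z i + t * d i := by
      intro i
      by_cases hi : i ∈ supp z
      · have hc : Tendsto (fun t : ℝ => z i + t * d i) (𝓝[>] 0) (𝓝 (z i)) := by
          have : Continuous fun t : ℝ => z i + t * d i := by fun_prop
          simpa using (this.tendsto 0).mono_left nhdsWithin_le_nhds
        exact (hc.eventually (lt_mem_nhds (hpos i hi))).mono fun _ h => h.le
      · simp [hd0 i hi, hz.1.1 i]
    obtain ⟨t, h1, h2⟩ := ((eventually_all.2 h).and self_mem_nhdsWithin).exists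
    exact ⟨t, h2, h1⟩
  -- The minimum of `z` and `z + t • d` is feasible: each row is compared with a vector attaining
  -- the minimum there. On the support both vectors have the same slack; off it both coordinates are
  -- zero, so `z` attains the minimum. At `i₀` it lies strictly below `z`.
  have := hleast (fun i => min (z i) ((z + t • d) i)) ?_ fun i => min_le_left _ _
  · have := congrFun this i₀
    simp only [Pi.add_apply, Pi.smul_apply, smul_eq_mul, min_eq_left_iff] at this
    nlinarith
  · refine ⟨fun i => le_min (hz.1.1 i) (ht' i), fun i => ?_⟩
    rcases min_choice (z i) ((z + t • d) i) with h | h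
    · have := hmono (x := z) (y := fun i => min (z i) ((z + t • d) i)) (fun i => min_le_left _ _) h
      linarith [hz.1.2 i]
    · have h1 := hmono (x := z + t • d) (y := fun i => min (z i) ((z + t • d) i))
        (fun i => min_le_right _ _) h
      rw [mulVec_add_smul] at h1
      by_cases hi : i ∈ supp z
      · rw [hd1 i hi] at h1
        linarith [hz.1.2 i]
      · have := hmono (x := z) (y := fun i => min (z i) ((z + t • d) i))
          (fun i => min_le_left _ _) (i := i) (by simp [notMem_supp.1 hi, hd0 i hi])
        linarith [hz.1.2 i]

/-! ### Adequate matrices -/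

/-- Ville's theorem of the alternative. -/
theorem exists_nonneg_vecMul_nonpos {α γ : Type*} [Fintype α] [Fintype γ] (N : Matrix α γ ℝ)
    (h : ¬ ∃ x : γ → ℝ, (∀ j, 0 ≤ x j) ∧ ∀ i, 0 < (N *ᵥ x) i) :
    ∃ e : α → ℝ, (∀ i, 0 ≤ e i) ∧ e ≠ 0 ∧ ∀ j, (e ᵥ* N) j ≤ 0 := by
  classical
  let s : Set (α → ℝ) := Set.univ.pi fun _ => Set.Ioi 0
  let t : Set (α → ℝ) := (fun x => N *ᵥ x) '' {x | ∀ j, 0 ≤ x j}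
  have hs : Convex ℝ s := convex_pi fun _ _ => convex_Ioi 0
  have hs' : IsOpen s := isOpen_set_pi Set.finite_univ fun _ _ => isOpen_Ioi
  have ht : Convex ℝ t := by
    have : Convex ℝ {x : γ → ℝ | ∀ j, 0 ≤ x j} := convex_Ici (0 : γ → ℝ)
    exact this.linear_image N.mulVecLin
  have hst : Disjoint s t := by
    rw [Set.disjoint_left]
    rintro _ hy ⟨x, hx, rfl⟩
    exact h ⟨x, hx, fun i => hy i trivial⟩
  -- Separation of the open positive orthant from the cone `t`. Passing to the closure of the
  -- orthant, and scaling in the cone, replaces the level `u` by zero; `e` is minus the coefficient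
  -- vector of `f`.
  obtain ⟨f, u, hfs, hft⟩ := geometric_hahn_banach_open hs hs' ht hst
  have hu : u ≤ 0 := by simpa using hft 0 ⟨0, fun _ => le_rfl, by simp⟩
  have hf1 : ∀ y : α → ℝ, (∀ i, 0 ≤ y i) → f y ≤ 0 := by
    intro y hy
    have hlim : Tendsto (fun r : ℝ => f (y + r • 1)) (𝓝[>] 0) (𝓝 (f y)) := by
      have : Continuous fun r : ℝ => f (y + r • 1) := by fun_prop
      simpa using (this.tendsto 0).mono_left nhdsWithin_le_nhds
    refine le_of_tendsto hlim ?_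
    filter_upwards [self_mem_nhdsWithin] with r hr
    refine ((hfs _ fun i _ => ?_).trans_le hu).le
    have : (0 : ℝ) < r := hr
    have := hy i
    simp
    positivity
  have hf2 : ∀ x : γ → ℝ, (∀ j, 0 ≤ x j) → 0 ≤ f (N *ᵥ x) := by
    intro x hx
    by_contra hneg
    push Not at hneg
    have h1 := hft _ ⟨((u - 1) / f (N *ᵥ x)) • x, fun j => ?_, rfl⟩
    · simp only [Matrix.mulVec_smul, map_smul, smul_eq_mul] at h1
      rw [div_mul_cancel₀ _ hneg.ne] at h1
      linarith
    · exact mul_nonneg (div_nonneg_of_nonpos (by linarith) hneg.le) (hx j)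
  have hrep : ∀ y : α → ℝ, f y = ∑ i, y i * f (Pi.single i 1) := by
    intro y
    conv_lhs => rw [pi_eq_sum_univ' y]
    simp [Pi.single]
  refine ⟨fun i => - f (Pi.single i 1), fun i => ?_, fun h0 => ?_, fun j => ?_⟩
  · have := hf1 (Pi.single i 1) fun j => by
      by_cases hij : j = i
      · subst hij; simp
      · simp [hij]
    linarith
  · have h1 := (hfs 1 fun i _ => by simp).trans_le hu
    rw [hrep] at h1
    have : ∀ i, f (Pi.single i 1) = 0 := fun i => by
      have := congrFun h0 i
      simpa using this
    simp [this] at h1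
  · have h1 := hf2 (Pi.single j 1) fun k => by
      by_cases hij : k = j
      · subst hij; simp
      · simp [hij]
    rw [hrep] at h1
    simp only [Matrix.vecMul, dotProduct, neg_mul, Finset.sum_neg_distrib]
    simp only [Matrix.mulVec_single_one, Matrix.col_apply] at h1
    have : ∑ i, f (Pi.single i 1) * N i j = ∑ i, N i j * f (Pi.single i 1) :=
      Finset.sum_congr rfl fun _ _ => mul_comm _ _
    linarith

theorem sum_mul_mulVec_comm {n : ℕ} (M : Matrix (Fin n) (Fin n) ℝ) (e z : Fin n → ℝ) :
    ∑ i, e i * (M *ᵥ z) i = ∑ j, (Mᵀ *ᵥ e) j * z j := by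
  have := Matrix.dotProduct_mulVec e M z
  rw [← Matrix.mulVec_transpose] at this
  exact this

/-- A nonnegative kernel vector of an adequate matrix has a companion in the left kernel. -/
theorem IsAdequate.exists_left_kernel {n : ℕ} {M : Matrix (Fin n) (Fin n) ℝ} (hM : IsAdequate M)
    {d : Fin n → ℝ} (hd : ∀ i, 0 ≤ d i) (hd0 : d ≠ 0) (hMd : M *ᵥ d = 0) :
    ∃ e : Fin n → ℝ, (∀ i, 0 ≤ e i) ∧ e ≠ 0 ∧ (∀ i, d i = 0 → e i = 0) ∧ Mᵀ *ᵥ e = 0 := by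
  classical
  set J := supp d with hJ
  have hdpos : ∀ i ∈ J, 0 < d i := fun i hi => lt_of_le_of_ne (hd i) (mem_supp.1 hi).symm
  have ext0 : ∀ x : J → ℝ, ∃ y : Fin n → ℝ, (∀ i ∉ J, y i = 0) ∧ (fun i : J => y i) = x := by
    intro x
    exact ⟨fun j => if h : j ∈ J then x ⟨j, h⟩ else 0, fun i hi => by simp [hi],
      by ext j; simp⟩
  -- If `M y > 0` on `J` with `y` supported in `J`, subtracting a large multiple of `d` makes the
  -- vector nonpositive on `J` without changing its image; column adequacy then forces `M y = 0`, a
  -- contradiction.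
  obtain ⟨e, he, he0, heN⟩ := exists_nonneg_vecMul_nonpos (principal M J) (by
    rintro ⟨x, hx, hMx⟩
    obtain ⟨y, hy0, hy⟩ := ext0 x
    have hy1 : ∀ i : J, 0 < (M *ᵥ y) i := fun i => by
      rw [← principal_mulVec M J y hy0 i, hy]; exact hMx i
    obtain ⟨r, hr⟩ : ∃ r : ℝ, ∀ i ∈ J, y i ≤ r * d i := by
      refine ⟨∑ i, |y i| / d i, fun i hi => ?_⟩
      have h1 : |y i| / d i ≤ ∑ i, |y i| / d i :=
        Finset.single_le_sum (f := fun i => |y i| / d i)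
          (fun j _ => div_nonneg (abs_nonneg _) (hd j)) (Finset.mem_univ i)
      rw [div_le_iff₀ (hdpos i hi)] at h1
      exact (le_abs_self _).trans h1
    have hMz : M *ᵥ (y + (-r) • d) = 0 := by
      refine hM.1 _ fun i => ?_
      rw [mulVec_add_smul, hMd]
      by_cases hi : i ∈ J
      · have h1 := hy1 ⟨i, hi⟩
        have h2 := hr i hi
        simp only [Pi.add_apply, Pi.smul_apply, smul_eq_mul, Pi.zero_apply, mul_zero, add_zero]
        exact mul_nonpos_of_nonpos_of_nonneg (by linarith) h1.le
      · simp [hy0 i hi, notMem_supp.1 hi]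
    obtain ⟨i, hi⟩ := Function.ne_iff.1 hd0
    have h1 := congrFun hMz i
    rw [mulVec_add_smul, hMd] at h1
    have := hy1 ⟨i, mem_supp.2 hi⟩
    simp only [Pi.zero_apply, mul_zero, add_zero] at h1
    exact this.ne' h1)
  obtain ⟨y, hy0, hy⟩ := ext0 e
  refine ⟨y, fun i => ?_, fun h0 => he0 ?_, fun i hi => hy0 i (notMem_supp.2 hi), ?_⟩
  · by_cases hi : i ∈ J
    · exact (congrFun hy ⟨i, hi⟩).symm ▸ he ⟨i, hi⟩
    · exact (hy0 i hi).ge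
  · rw [← hy, h0]; rfl
  -- The alternative only gives `Mᵀ e ≤ 0` on `J`; row adequacy upgrades it to equality everywhere.
  · refine hM.2 y fun i => ?_
    by_cases hi : i ∈ J
    · have h1 := principal_mulVec Mᵀ J y hy0 ⟨i, hi⟩
      have h2 : (e ᵥ* principal M J) ⟨i, hi⟩ = (Mᵀ *ᵥ y) i := by
        rw [← h1, hy, ← Matrix.mulVec_transpose]; rfl
      rw [← h2]
      have h3 : y i = e ⟨i, hi⟩ := congrFun hy ⟨i, hi⟩
      rw [h3]
      exact mul_nonpos_of_nonneg_of_nonpos (he _) (heN _)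
    · rw [hy0 i hi, zero_mul]

/-- Under strict feasibility the map `z ↦ z ∘ (M z + q)` is proper on the feasible set. -/
theorem IsAdequate.exists_norm_bound {n : ℕ} {M : Matrix (Fin n) (Fin n) ℝ} (hM : IsAdequate M)
    {q v : Fin n → ℝ} (hv : ∀ i, 0 < (M *ᵥ v) i + q i) (b : ℝ) :
    ∃ R : ℝ, ∀ z : Fin n → ℝ, (∀ i, 0 ≤ z i) → (∀ i, 0 ≤ (M *ᵥ z) i + q i) →
      (∀ i, z i * ((M *ᵥ z) i + q i) ≤ b) → ‖z‖ ≤ R := by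
  by_contra! hcon
  choose z hz0 hw0 hzb hzn using fun k : ℕ => hcon (k + 1)
  have hpos : ∀ k, 0 < ‖z k‖ := fun k => lt_trans (by positivity) (hzn k)
  have hinf : Tendsto (fun k => ‖z k‖) atTop atTop :=
    tendsto_atTop_mono (fun k => (hzn k).le)
      (tendsto_atTop_add_const_right _ _ tendsto_natCast_atTop_atTop)
  -- An unbounded sequence, normalized, has a limit direction `d ≥ 0` with `d i * (M d) i = 0`,
  -- hence `M d = 0`.
  obtain ⟨d, hd, φ, hφ, hlim⟩ := (isCompact_sphere (0 : Fin n → ℝ) 1).tendsto_subseq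
    (x := fun k => (‖z k‖)⁻¹ • z k) fun k => by
      simp [norm_smul, (hpos k).ne']
  have hd1 : ‖d‖ = 1 := by simpa using hd
  have hd0 : d ≠ 0 := by rintro rfl; simp at hd1
  have hr : Tendsto (fun k => (‖z (φ k)‖)⁻¹) atTop (𝓝 0) :=
    tendsto_inv_atTop_zero.comp (hinf.comp hφ.tendsto_atTop)
  have hlim' := fun i => (tendsto_pi_nhds.1 hlim) i
  have hdn : ∀ i, 0 ≤ d i := fun i => ge_of_tendsto' (hlim' i) fun k => by
    simpa using mul_nonneg (inv_nonneg.2 (norm_nonneg _)) (hz0 (φ k) i)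
  have hc : Continuous fun x : Fin n → ℝ => M *ᵥ x := by fun_prop
  -- the scaled slack converges to `M d`
  have hMd : ∀ i, Tendsto (fun k => (‖z (φ k)‖)⁻¹ * ((M *ᵥ z (φ k)) i + q i)) atTop
      (𝓝 ((M *ᵥ d) i)) := by
    intro i
    have h1 := (tendsto_pi_nhds.1 ((hc.tendsto d).comp hlim)) i
    have h2 := h1.add (hr.mul_const (q i))
    simp only [zero_mul, add_zero] at h2
    refine h2.congr fun k => ?_
    simp [Matrix.mulVec_smul]
    ring
  have hpd : ∀ i, Tendsto (fun k => ((‖z (φ k)‖)⁻¹ • z (φ k)) i * ((M *ᵥ z (φ k)) i + q i))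
      atTop (𝓝 0) := by
    intro i
    have hb : Tendsto (fun k => (‖z (φ k)‖)⁻¹ * b) atTop (𝓝 0) := by
      simpa using hr.mul_const b
    refine tendsto_of_tendsto_of_tendsto_of_le_of_le tendsto_const_nhds hb (fun k => ?_)
      fun k => ?_
    · exact mul_nonneg (mul_nonneg (inv_nonneg.2 (norm_nonneg _)) (hz0 _ i)) (hw0 _ i)
    · simp only [Pi.smul_apply, smul_eq_mul, mul_assoc]
      exact mul_le_mul_of_nonneg_left (hzb _ i) (inv_nonneg.2 (norm_nonneg _))
  have hMd0 : M *ᵥ d = 0 := by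
    refine hM.1 d fun i => le_of_eq ?_
    have h1 := (hlim' i).mul (hMd i)
    have h2 := hr.mul (hpd i)
    rw [zero_mul] at h2
    refine tendsto_nhds_unique h1 (h2.congr fun k => ?_)
    simp only [Function.comp]
    ring
  obtain ⟨e, he, he0, hed, hMe⟩ := hM.exists_left_kernel hdn hd0 hMd0
  -- The `e`-weighted slack is the same at every point. Along the sequence it tends to zero, since
  -- `e` lives where `d > 0` and the slack tends to zero there; at `v` it is positive.
  have hconst : ∀ x : Fin n → ℝ, ∑ i, e i * ((M *ᵥ x) i + q i) = ∑ i, e i * q i := by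
    intro x
    simp only [mul_add, Finset.sum_add_distrib]
    rw [sum_mul_mulVec_comm, hMe]
    simp
  have hlim0 : Tendsto (fun k => ∑ i, e i * ((M *ᵥ z (φ k)) i + q i)) atTop (𝓝 (∑ i : Fin n, 0)) := by
    refine tendsto_finsetSum _ fun i _ => ?_
    by_cases hi : d i = 0
    · simp [hed i hi]
    · have h1 := ((hpd i).div (hlim' i) hi).const_mul (e i)
      rw [zero_div, mul_zero] at h1
      refine h1.congr' ?_
      filter_upwards [(hlim' i).eventually_ne hi] with k hk
      simp only [Function.comp] at hk
      simp only [Pi.div_apply, Function.comp]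
      rw [mul_div_cancel_left₀ _ hk]
  simp only [hconst, Finset.sum_const_zero] at hlim0
  have h0 := tendsto_nhds_unique tendsto_const_nhds hlim0
  rw [← hconst v] at h0
  obtain ⟨i, hi⟩ := Function.ne_iff.1 he0
  rw [Finset.sum_eq_zero_iff_of_nonneg fun i _ => mul_nonneg (he i) (hv i).le] at h0
  exact (mul_ne_zero hi (hv i).ne') (h0 i (Finset.mem_univ i))

/-- The central path exists under strict feasibility. -/
theorem IsAdequate.exists_central {n : ℕ} {M : Matrix (Fin n) (Fin n) ℝ} (hM : IsAdequate M)
    {q v : Fin n → ℝ} (hv : ∀ i, 0 < v i) (hv' : ∀ i, 0 < (M *ᵥ v) i + q i) {μ : ℝ}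
    (hμ : 0 < μ) :
    ∃ z : Fin n → ℝ, (∀ i, 0 < z i) ∧ (∀ i, 0 < (M *ᵥ z) i + q i) ∧
      ∀ i, z i * ((M *ᵥ z) i + q i) = μ := by
  set p : (Fin n → ℝ) → Fin n → ℝ := fun z i => z i * ((M *ᵥ z) i + q i) with hp
  -- Each summand is least exactly at `p z i = μ` and blows up as `p z i` tends to `0` or infinity.
  set Ψ : (Fin n → ℝ) → ℝ := fun z => ∑ i, (p z i + μ ^ 2 / p z i) with hΨ
  set c := Ψ v with hc
  have hpc : ∀ i, Continuous fun z => p z i := fun i => by simp only [hp]; fun_prop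
  -- The bounds `p ≤ c` and `p ≥ μ² / c` implied by `Ψ ≤ c`, free of division so that `S` is closed.
  -- The first bounds `S`, the second keeps it in the interior.
  let S : Set (Fin n → ℝ) := ({z | ∀ i, 0 ≤ z i} ∩ {z | ∀ i, 0 ≤ (M *ᵥ z) i + q i}) ∩
    ({z | ∀ i, 0 ≤ c - p z i} ∩ {z | ∀ i, 0 ≤ c * p z i - μ ^ 2})
  have hSclosed : IsClosed S := by
    refine ((isClosed_forall_nonneg fun i => ?_).inter (isClosed_forall_nonneg fun i => ?_)).inter
      ((isClosed_forall_nonneg fun i => ?_).inter (isClosed_forall_nonneg fun i => ?_))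
    · fun_prop
    · fun_prop
    · exact continuous_const.sub (hpc i)
    · exact (continuous_const.mul (hpc i)).sub continuous_const
  obtain ⟨R, hR⟩ := hM.exists_norm_bound hv' c
  have hScomp : IsCompact S := (isCompact_closedBall (0 : Fin n → ℝ) R).of_isClosed_subset
    hSclosed fun z hz => by
      rw [mem_closedBall_zero_iff]
      exact hR z hz.1.1 hz.1.2 fun i => by have := hz.2.1 i; linarith
  have hSpos : ∀ z ∈ S, (∀ i, 0 < z i) ∧ (∀ i, 0 < (M *ᵥ z) i + q i) ∧ ∀ i, 0 < p z i := by
    intro z hz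
    have hne : ∀ i, p z i ≠ 0 := fun i h => by
      have := hz.2.2 i
      rw [h, mul_zero, zero_sub] at this
      nlinarith
    have h1 : ∀ i, 0 < z i := fun i =>
      lt_of_le_of_ne (hz.1.1 i) fun h => hne i (by simp [hp, ← h])
    have h2 : ∀ i, 0 < (M *ᵥ z) i + q i := fun i =>
      lt_of_le_of_ne (hz.1.2 i) fun h => hne i (by simp [hp, ← h])
    exact ⟨h1, h2, fun i => mul_pos (h1 i) (h2 i)⟩
  have hmemS : ∀ z : Fin n → ℝ, (∀ i, 0 < z i) → (∀ i, 0 < (M *ᵥ z) i + q i) → Ψ z ≤ c →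
      z ∈ S := by
    intro z h1 h2 h3
    have hpp : ∀ i, 0 < p z i := fun i => mul_pos (h1 i) (h2 i)
    have hterm : ∀ i, p z i + μ ^ 2 / p z i ≤ c := fun i =>
      (Finset.single_le_sum (f := fun i => p z i + μ ^ 2 / p z i)
        (fun j _ => by have := hpp j; positivity) (Finset.mem_univ i)).trans h3
    refine ⟨⟨fun i => (h1 i).le, fun i => (h2 i).le⟩, fun i => ?_, fun i => ?_⟩
    · have := hterm i
      have : 0 ≤ μ ^ 2 / p z i := by have := hpp i; positivity
      linarith
    · have h4 : μ ^ 2 / p z i ≤ c := by linarith [hterm i, hpp i]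
      rw [div_le_iff₀ (hpp i)] at h4
      linarith
  have hΨc : ContinuousOn Ψ S := by
    refine continuousOn_finsetSum _ fun i _ => (hpc i).continuousOn.add ?_
    exact continuousOn_const.div (hpc i).continuousOn fun z hz => ((hSpos z hz).2.2 i).ne'
  obtain ⟨z, hz, hzmin⟩ := hScomp.exists_isMinOn ⟨v, hmemS v hv hv' le_rfl⟩ hΨc
  obtain ⟨hz0, hw0, hp0⟩ := hSpos z hz
  have hglob : ∀ y : Fin n → ℝ, (∀ i, 0 < y i) → (∀ i, 0 < (M *ᵥ y) i + q i) → Ψ z ≤ Ψ y := by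
    intro y h1 h2
    rcases le_total (Ψ y) c with h | h
    · exact hzmin (hmemS y h1 h2 h)
    · exact (hzmin (hmemS v hv hv' le_rfl)).trans h
  set w : Fin n → ℝ := fun i => (M *ᵥ z) i + q i with hw
  set a : Fin n → ℝ := fun i => 1 - μ ^ 2 / (p z i) ^ 2 with ha
  have hstat : ∀ h : Fin n → ℝ, ∑ i, a i * (h i * w i + z i * (M *ᵥ h) i) = 0 := by
    intro h
    have hline : ∀ i, HasDerivAt (fun t : ℝ => p (z + t • h) i) (h i * w i + z i * (M *ᵥ h) i) 0 := by
      intro i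
      have h1 : HasDerivAt (fun t : ℝ => z i + t * h i) (h i) 0 := by
        simpa using ((hasDerivAt_id (0 : ℝ)).mul_const (h i)).const_add (z i)
      have h2 : HasDerivAt (fun t : ℝ => (M *ᵥ z) i + t * (M *ᵥ h) i + q i) ((M *ᵥ h) i) 0 := by
        simpa using (((hasDerivAt_id (0 : ℝ)).mul_const ((M *ᵥ h) i)).const_add
          ((M *ᵥ z) i)).add_const (q i)
      have h3 := h1.mul h2
      simp only [zero_mul, add_zero] at h3
      refine h3.congr_of_eventuallyEq (Eventually.of_forall fun t => ?_)
      simp only [hp, mulVec_add_smul]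
      simp
    have hp00 : ∀ i, p (z + (0 : ℝ) • h) i = p z i := fun i => by simp
    have hd : HasDerivAt (fun t : ℝ => Ψ (z + t • h))
        (∑ i, a i * (h i * w i + z i * (M *ᵥ h) i)) 0 := by
      refine HasDerivAt.fun_sum fun i _ => ?_
      have h1 := (hline i).fun_add (((hasDerivAt_const (0 : ℝ) (μ ^ 2))).fun_div (hline i)
        (by rw [hp00]; exact (hp0 i).ne'))
      simp only [hp00] at h1
      refine h1.congr_deriv ?_
      simp only [ha]
      ring
    refine IsLocalMin.hasDerivAt_eq_zero ?_ hd
    have hcz : Continuous fun t : ℝ => z + t • h := by fun_prop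
    have e1 : ∀ᶠ t : ℝ in 𝓝 0, ∀ i, 0 < (z + t • h) i := by
      refine eventually_all.2 fun i => ?_
      have : Continuous fun t : ℝ => (z + t • h) i := by fun_prop
      exact this.continuousAt.eventually (lt_mem_nhds (by simpa using hz0 i))
    have e2 : ∀ᶠ t : ℝ in 𝓝 0, ∀ i, 0 < (M *ᵥ (z + t • h)) i + q i := by
      refine eventually_all.2 fun i => ?_
      have : Continuous fun t : ℝ => (M *ᵥ (z + t • h)) i + q i := by fun_prop
      exact this.continuousAt.eventually (lt_mem_nhds (by simpa using hw0 i))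
    filter_upwards [e1, e2] with t h1 h2
    simpa using hglob _ h1 h2
  have hcoord : ∀ j, a j * w j + (Mᵀ *ᵥ fun i => a i * z i) j = 0 := by
    intro j
    have h1 := hstat (Pi.single j 1)
    simp only [mul_add, Finset.sum_add_distrib] at h1
    have h2 : ∑ i, a i * (z i * (M *ᵥ Pi.single j 1) i) =
        (Mᵀ *ᵥ fun i => a i * z i) j := by
      have := sum_mul_mulVec_comm M (fun i => a i * z i) (Pi.single j 1)
      simp only [Pi.single_apply, mul_ite, mul_one, mul_zero, Finset.sum_ite_eq',
        Finset.mem_univ, if_true] at this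
      rw [← this]
      exact Finset.sum_congr rfl fun i _ => (mul_assoc _ _ _).symm
    rw [h2] at h1
    simpa [Pi.single_apply] using h1
  -- By stationarity the products are `-(a i)² * p z i ≤ 0`, so row adequacy applies. Then `a i * w
  -- i = 0`, hence `a = 0` and `p = μ`.
  have hzero : Mᵀ *ᵥ (fun i => a i * z i) = 0 := by
    refine hM.2 _ fun i => ?_
    have h1 : (Mᵀ *ᵥ fun i => a i * z i) i = - (a i * w i) := by linarith [hcoord i]
    rw [h1]
    have : a i * z i * -(a i * w i) = -(a i ^ 2 * (z i * w i)) := by ring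
    rw [this, neg_nonpos]
    exact mul_nonneg (sq_nonneg _) (hp0 i).le
  refine ⟨z, hz0, hw0, fun i => ?_⟩
  have h1 := hcoord i
  rw [hzero, Pi.zero_apply, add_zero] at h1
  have h2 : 1 - μ ^ 2 / (p z i) ^ 2 = 0 := (mul_eq_zero.1 h1).resolve_right (hw0 i).ne'
  have h3 := (hp0 i).ne'
  have h4 : (p z i) ^ 2 = μ ^ 2 := by
    field_simp at h2
    linarith
  exact (pow_left_inj₀ (hp0 i).le hμ.le two_ne_zero).1 h4

/-- Central points for `μ = 1 / (k + 1)` stay bounded by properness; a cluster point is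
complementary. -/
theorem IsAdequate.exists_solution_of_strict {n : ℕ} {M : Matrix (Fin n) (Fin n) ℝ}
    (hM : IsAdequate M) {q v : Fin n → ℝ} (hv : ∀ i, 0 < v i)
    (hv' : ∀ i, 0 < (M *ᵥ v) i + q i) : ∃ z, IsLCPSolution M q z := by
  choose z hz0 hw0 hzw using fun k : ℕ =>
    hM.exists_central hv hv' (μ := 1 / ((k : ℝ) + 1)) (by positivity)
  obtain ⟨R, hR⟩ := hM.exists_norm_bound hv' 1
  have hmem : ∀ k, z k ∈ Metric.closedBall (0 : Fin n → ℝ) R := fun k => by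
    rw [mem_closedBall_zero_iff]
    refine hR _ (fun i => (hz0 k i).le) (fun i => (hw0 k i).le) fun i => ?_
    rw [hzw k i, div_le_one (by positivity)]
    linarith [(Nat.cast_nonneg k : (0 : ℝ) ≤ k)]
  obtain ⟨y, -, φ, hφ, hlim⟩ := (isCompact_closedBall (0 : Fin n → ℝ) R).tendsto_subseq hmem
  refine ⟨y, IsLCPSolution.of_tendsto (qs := fun _ => q) tendsto_const_nhds hlim
    (fun k i => (hz0 _ i).le) (fun k i => (hw0 _ i).le) fun i => ?_⟩
  simp only [Function.comp, hzw]
  exact tendsto_one_div_add_atTop_nhds_zero_nat.comp hφ.tendsto_atTop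

/-- Raising `q` by `η > 0` makes a small shift of `v` strictly feasible. Basic solutions of the
perturbed problems obey the `beta` bound with a constant independent of `η`; that bound, not
basicness, passes to the limit. -/
theorem IsAdequate.exists_solution_le {n : ℕ} {M : Matrix (Fin n) (Fin n) ℝ}
    (hM : IsAdequate M) {q v : Fin n → ℝ} (hv : ∀ i, 0 ≤ v i)
    (hv' : ∀ i, 0 ≤ (M *ᵥ v) i + q i) :
    ∃ z, IsLCPSolution M q z ∧ ∑ i, |z i| ≤ beta M * ∑ i, |q i| := by
  set η : ℕ → ℝ := fun k => 1 / ((k : ℝ) + 1) with hη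
  have hη0 : ∀ k, 0 < η k := fun k => by simp only [hη]; positivity
  have hη1 : ∀ k, η k ≤ 1 := fun k => by
    simp only [hη]
    rw [div_le_one (by positivity)]
    linarith [(Nat.cast_nonneg k : (0 : ℝ) ≤ k)]
  have hηlim : Tendsto η atTop (𝓝 0) := tendsto_one_div_add_atTop_nhds_zero_nat
  have hex : ∀ k, ∃ z, IsLCPSolution M (fun i => q i + η k) z ∧
      ∑ i, |z i| ≤ beta M * ∑ i, |q i + η k| := by
    intro k
    obtain ⟨t, ht, ht'⟩ : ∃ t : ℝ, 0 < t ∧ ∀ i, 0 < (M *ᵥ (v + t • 1)) i + (q i + η k) := by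
      have h : ∀ i, ∀ᶠ t in 𝓝[>] (0 : ℝ), 0 < (M *ᵥ (v + t • 1)) i + (q i + η k) := by
        intro i
        have : Continuous fun t : ℝ => (M *ᵥ (v + t • 1)) i + (q i + η k) := by fun_prop
        refine nhdsWithin_le_nhds (this.continuousAt.eventually (lt_mem_nhds ?_))
        simpa [← add_assoc] using add_pos_of_nonneg_of_pos (hv' i) (hη0 k)
      obtain ⟨t, h1, h2⟩ := ((eventually_all.2 h).and self_mem_nhdsWithin).exists
      exact ⟨t, h2, h1⟩
    obtain ⟨z, hz⟩ := hM.exists_solution_of_strict (q := fun i => q i + η k)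
      (v := v + t • 1) (fun i => by have := hv i; simp; linarith) ht'
    obtain ⟨z', hz', hdet⟩ := hM.1.exists_basic hz
    exact ⟨z', hz', hz'.sum_abs_le hdet⟩
  choose z hz hzb using hex
  have hqlim : Tendsto (fun k i => q i + η k) atTop (𝓝 q) :=
    tendsto_pi_nhds.2 fun i => by simpa using hηlim.const_add (q i)
  have hmem : ∀ k, z k ∈ Metric.closedBall (0 : Fin n → ℝ) (beta M * ∑ i, (|q i| + 1)) := by
    intro k
    have hβ := beta_nonneg M
    have hle : beta M * ∑ i, |q i + η k| ≤ beta M * ∑ i, (|q i| + 1) := by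
      refine mul_le_mul_of_nonneg_left (Finset.sum_le_sum fun i _ => ?_) hβ
      refine (abs_add_le _ _).trans ?_
      rw [abs_of_pos (hη0 k)]
      linarith [hη1 k]
    rw [mem_closedBall_zero_iff, pi_norm_le_iff_of_nonneg (by positivity)]
    intro i
    exact (Finset.single_le_sum (f := fun i => |z k i|) (fun _ _ => abs_nonneg _)
      (Finset.mem_univ i)).trans ((hzb k).trans hle)
  obtain ⟨y, -, φ, hφ, hlim⟩ := (isCompact_closedBall _ _).tendsto_subseq hmem
  have hqφ := hqlim.comp hφ.tendsto_atTop
  refine ⟨y, IsLCPSolution.of_tendsto hqφ hlim (fun k i => (hz _).nonneg i)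
    (fun k i => (hz _).slack_nonneg i) fun i => ?_, ?_⟩
  · refine tendsto_const_nhds.congr fun k => ?_
    exact ((hz (φ k)).compl i).symm
  · have h1 : Continuous fun x : Fin n → ℝ => ∑ i, |x i| := by fun_prop
    exact le_of_tendsto_of_tendsto' ((h1.tendsto y).comp hlim)
      (((h1.tendsto q).comp hqφ).const_mul (beta M)) fun k => hzb (φ k)

/-- Feasible complementarity problems with an adequate or a `Z`-matrix have a solution bounded by
`beta`. -/
theorem exists_lcp_solution_le {n : ℕ} {M : Matrix (Fin n) (Fin n) ℝ}
    (hM : IsAdequate M ∨ IsZMatrix M) {q v : Fin n → ℝ} (hv : ∀ i, 0 ≤ v i)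
    (hv' : ∀ i, 0 ≤ (M *ᵥ v) i + q i) :
    ∃ z, IsLCPSolution M q z ∧ ∑ i, |z i| ≤ beta M * ∑ i, |q i| := by
  rcases hM with hM | hM
  · exact hM.exists_solution_le hv hv'
  · obtain ⟨z, hz, hdet⟩ := hM.exists_basic hv hv'
    exact ⟨z, hz, hz.sum_abs_le hdet⟩

/-! ### Primitives and `H¹(0,T)` -/

section Primitive

variable {E : Type*} [NormedAddCommGroup E] [NormedSpace ℝ E]

/-- The primitive, vanishing at `0`, of a function on `(0,T)` extended by zero. -/
noncomputable def prim (T : ℝ) (v : ℝ → E) (t : ℝ) : E :=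
  ∫ s in (0 : ℝ)..t, (Set.Ioo 0 T).indicator v s

theorem prim_zero (T : ℝ) (v : ℝ → E) : prim T v 0 = 0 := by simp [prim]

theorem integrable_indicator_Ioo {E : Type*} [NormedAddCommGroup E] {T : ℝ} {v : ℝ → E} (hv : Integrable v (timeMeasure T)) :
    Integrable ((Set.Ioo 0 T).indicator v) :=
  (integrable_indicator_iff measurableSet_Ioo).2 hv

theorem continuous_prim {T : ℝ} {v : ℝ → E} (hv : Integrable v (timeMeasure T)) :
    Continuous (prim T v) :=
  intervalIntegral.continuous_primitive
    (fun _ _ => (integrable_indicator_Ioo hv).intervalIntegrable) 0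

theorem prim_congr_ae {T : ℝ} {v w : ℝ → E} (h : v =ᵐ[timeMeasure T] w) : prim T v = prim T w := by
  ext t
  refine intervalIntegral.integral_congr_ae ?_
  have h' := (ae_restrict_iff' measurableSet_Ioo).1 h
  filter_upwards [h'] with s hs _
  by_cases hs' : s ∈ Set.Ioo 0 T
  · simp [hs', hs hs']
  · simp [hs']

/-- A domain of integration independent of `t` prepares for Fubini. -/
theorem prim_eq_setIntegral {T : ℝ} (v : ℝ → E) {t : ℝ} (ht : 0 ≤ t) :
    prim T v t = ∫ s in Set.Ioo 0 T, (Set.Iic t).indicator v s := by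
  rw [prim, intervalIntegral.integral_of_le ht, ← integral_indicator measurableSet_Ioc,
    ← integral_indicator measurableSet_Ioo]
  congr 1
  ext s
  simp only [Set.indicator_apply, Set.mem_Ioc, Set.mem_Ioo, Set.mem_Iic]
  split_ifs <;> first | rfl | (exfalso; grind)

theorem norm_prim_le {T : ℝ} {v : ℝ → E} (hv : Integrable v (timeMeasure T)) {t : ℝ} (ht : 0 ≤ t) :
    ‖prim T v t‖ ≤ ∫ s in Set.Ioo 0 T, ‖v s‖ := by
  rw [prim_eq_setIntegral v ht]
  refine (norm_integral_le_integral_norm _).trans ?_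
  refine integral_mono_of_nonneg (Eventually.of_forall fun _ => norm_nonneg _) hv.norm
    (Eventually.of_forall fun s => ?_)
  exact norm_indicator_le_norm_self _ _

theorem prim_add {T : ℝ} {v w : ℝ → E} (hv : Integrable v (timeMeasure T))
    (hw : Integrable w (timeMeasure T)) (t : ℝ) : prim T (v + w) t = prim T v t + prim T w t := by
  simp only [prim, Set.indicator_add']
  exact intervalIntegral.integral_add (integrable_indicator_Ioo hv).intervalIntegrable
    (integrable_indicator_Ioo hw).intervalIntegrable

theorem prim_smul {T : ℝ} (c : ℝ) (v : ℝ → E) (t : ℝ) : prim T (c • v) t = c • prim T v t := by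
  simp only [prim]
  rw [← intervalIntegral.integral_smul]
  congr 1
  ext s
  simp [Set.indicator_apply]

/-- A test function on `(0,T)` vanishes at the end points. -/
theorem eq_zero_of_tsupport_subset {T : ℝ} {φ : ℝ → ℝ} (hφ : tsupport φ ⊆ Set.Ioo 0 T) :
    φ 0 = 0 ∧ φ T = 0 :=
  ⟨image_eq_zero_of_notMem_tsupport fun h => by simpa using hφ h,
    image_eq_zero_of_notMem_tsupport fun h => by simpa using hφ h⟩

/-- The inner integral after Fubini is `φ T - φ s`; at `s = 0` it says that `deriv φ` has mean zero.
-/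
theorem integral_deriv_indicator {T : ℝ} {φ : ℝ → ℝ}
    (hφ : ContDiff ℝ ((⊤ : ℕ∞) : WithTop ℕ∞) φ) (hs : tsupport φ ⊆ Set.Ioo 0 T) {s : ℝ}
    (h : s ∈ Set.Ico 0 T) :
    ∫ t in Set.Ioo 0 T, (Set.Ici s).indicator (deriv φ) t = - φ s := by
  have h1 : ∫ t in Set.Ioo 0 T, (Set.Ici s).indicator (deriv φ) t = ∫ t in s..T, deriv φ t := by
    rw [intervalIntegral.integral_of_le h.2.le, integral_Ioc_eq_integral_Ioo,
      ← integral_Ico_eq_integral_Ioo, ← integral_indicator measurableSet_Ico,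
      ← integral_Ico_eq_integral_Ioo, ← integral_indicator measurableSet_Ico]
    congr 1
    ext t
    simp only [Set.indicator_apply, Set.mem_Ico, Set.mem_Ici]
    have := h.1
    split_ifs <;> first | rfl | (exfalso; grind)
  rw [h1, intervalIntegral.integral_deriv_eq_sub, (eq_zero_of_tsupport_subset hs).2, zero_sub]
  · exact fun x _ => (hφ.differentiable (by simp)).differentiableAt
  · exact (hφ.continuous_deriv (by simp)).intervalIntegrable _ _

variable [CompleteSpace E]

/-- Integration by parts of a primitive against a test function. -/
theorem integral_deriv_smul_prim {T : ℝ} {v : ℝ → E} (hv : Integrable v (timeMeasure T))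
    {φ : ℝ → ℝ} (hφ : ContDiff ℝ ((⊤ : ℕ∞) : WithTop ℕ∞) φ) (hc : HasCompactSupport φ)
    (hs : tsupport φ ⊆ Set.Ioo 0 T) :
    ∫ t in Set.Ioo 0 T, deriv φ t • prim T v t = - ∫ t in Set.Ioo 0 T, φ t • v t := by
  have hdc : Continuous (deriv φ) := hφ.continuous_deriv (by simp)
  have hdi : Integrable (deriv φ) (timeMeasure T) :=
    (hdc.integrable_of_hasCompactSupport hc.deriv).integrableOn
  have hprod : Integrable (Function.uncurry fun t s => (Set.Iic t).indicator (fun s => deriv φ t • v s) s)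
      ((timeMeasure T).prod (timeMeasure T)) := by
    have h1 : Integrable (fun p : ℝ × ℝ => deriv φ p.1 • v p.2)
        ((timeMeasure T).prod (timeMeasure T)) := hdi.smul_prod hv
    have h2 := h1.indicator (s := {p : ℝ × ℝ | p.2 ≤ p.1})
      (measurableSet_le measurable_snd measurable_fst)
    refine h2.congr (Eventually.of_forall fun p => ?_)
    simp [Function.uncurry, Set.indicator_apply]
  calc ∫ t in Set.Ioo 0 T, deriv φ t • prim T v t
      = ∫ t in Set.Ioo 0 T, ∫ s in Set.Ioo 0 T,
          (Set.Iic t).indicator (fun s => deriv φ t • v s) s := by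
        refine setIntegral_congr_fun measurableSet_Ioo fun t ht => ?_
        rw [prim_eq_setIntegral v ht.1.le, ← integral_smul]
        congr 1
        ext s
        simp [Set.indicator_apply]
    _ = ∫ s in Set.Ioo 0 T, ∫ t in Set.Ioo 0 T,
          (Set.Iic t).indicator (fun s => deriv φ t • v s) s := integral_integral_swap hprod
    _ = ∫ s in Set.Ioo 0 T, - (φ s • v s) := by
        refine setIntegral_congr_fun measurableSet_Ioo fun s h => ?_
        rw [← neg_smul, ← integral_deriv_indicator hφ hs ⟨h.1.le, h.2⟩, ← integral_smul_const]
        congr 1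
        ext t
        simp [Set.indicator_apply]
    _ = _ := integral_neg _

theorem integral_deriv_smul_const {T : ℝ} (hT : 0 < T) {φ : ℝ → ℝ}
    (hφ : ContDiff ℝ ((⊤ : ℕ∞) : WithTop ℕ∞) φ) (hs : tsupport φ ⊆ Set.Ioo 0 T) (c : E) :
    ∫ t in Set.Ioo 0 T, deriv φ t • c = 0 := by
  have h1 := integral_deriv_indicator hφ hs (s := 0) ⟨le_rfl, hT⟩
  rw [(eq_zero_of_tsupport_subset hs).1, neg_zero] at h1
  rw [integral_smul_const, ← setIntegral_congr_fun measurableSet_Ioo fun t ht => ?_, h1, zero_smul]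
  have : t ∈ Set.Ici 0 := ht.1.le
  simp [this]

end Primitive

/-- A test function of zero mean is the derivative of a test function. -/
theorem exists_deriv_eq {T : ℝ} {χ : ℝ → ℝ}
    (hχ : ContDiff ℝ ((⊤ : ℕ∞) : WithTop ℕ∞) χ) (hc : HasCompactSupport χ)
    (hs : tsupport χ ⊆ Set.Ioo 0 T) (h0 : ∫ t, χ t = 0) :
    ∃ φ : ℝ → ℝ, ContDiff ℝ ((⊤ : ℕ∞) : WithTop ℕ∞) φ ∧ HasCompactSupport φ ∧
      tsupport φ ⊆ Set.Ioo 0 T ∧ deriv φ = χ := by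
  rcases (tsupport χ).eq_empty_or_nonempty with he | hne
  · have hz : χ = 0 := tsupport_eq_empty_iff.1 he
    exact ⟨0, contDiff_zero_fun, HasCompactSupport.zero, by
      rw [tsupport_eq_empty_iff.2 rfl]; exact Set.empty_subset _, by rw [hz]; exact deriv_zero⟩
  obtain ⟨a, ha, hamin⟩ := hc.isCompact.exists_isLeast hne
  obtain ⟨b, hb, hbmax⟩ := hc.isCompact.exists_isGreatest hne
  have hsub : Function.support χ ⊆ Set.Icc a b := fun t ht =>
    ⟨hamin (subset_tsupport χ ht), hbmax (subset_tsupport χ ht)⟩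
  -- The primitive vanishes left of the support of `χ`, and right of it because the mean is zero.
  set φ : ℝ → ℝ := fun t => ∫ s in (0 : ℝ)..t, χ s with hφ
  have hderiv : ∀ t, HasDerivAt φ (χ t) t := fun t =>
    intervalIntegral.integral_hasDerivAt_right (hχ.continuous.intervalIntegrable _ _)
      (hχ.continuous.stronglyMeasurableAtFilter _ _) hχ.continuous.continuousAt
  have hd : deriv φ = χ := funext fun t => (hderiv t).deriv
  have hsupp : Function.support φ ⊆ Set.Icc a b := by
    intro t ht
    by_contra hcon
    apply ht
    rw [Set.mem_Icc, not_and_or, not_le, not_le] at hcon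
    rcases hcon with h | h
    · refine intervalIntegral.integral_zero_ae (Eventually.of_forall fun s hs' => ?_)
      by_contra hne'
      have := (hsub hne').1
      rcases hs' with ⟨_, h2⟩
      have h3 : max 0 t < a := max_lt (hs ha).1 h
      linarith
    · have : ∫ s in (0 : ℝ)..t, χ s = ∫ s, χ s := by
        refine intervalIntegral.integral_eq_integral_of_support_subset fun s hs' => ?_
        have h1 := hsub hs'
        exact ⟨(hs ha).1.trans_le h1.1, h1.2.trans h.le⟩
      simp only [hφ, this, h0]
  have hts : tsupport φ ⊆ Set.Icc a b := closure_minimal hsupp isClosed_Icc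
  refine ⟨φ, ?_, HasCompactSupport.of_support_subset_isCompact isCompact_Icc hsupp,
    hts.trans (Set.Icc_subset_Ioo (hs ha).1 (hs hb).2), hd⟩
  rw [contDiff_infty_iff_deriv, hd]
  exact ⟨fun t => (hderiv t).differentiableAt, hχ⟩

/-- The du Bois-Reymond lemma. -/
theorem exists_ae_eq_const {E : Type*} [NormedAddCommGroup E] [NormedSpace ℝ E] [CompleteSpace E]
    {T : ℝ} (hT : 0 < T) {y : ℝ → E} (hy : Integrable y (timeMeasure T))
    (h : ∀ φ : ℝ → ℝ, ContDiff ℝ ((⊤ : ℕ∞) : WithTop ℕ∞) φ → HasCompactSupport φ →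
      tsupport φ ⊆ Set.Ioo 0 T → ∫ t in Set.Ioo 0 T, deriv φ t • y t = 0) :
    ∃ c : E, ∀ᵐ t ∂(timeMeasure T), y t = c := by
  obtain ⟨ρ, hρs, hρc, hρd, hρ1⟩ : ∃ ρ : ℝ → ℝ, tsupport ρ ⊆ Set.Ioo 0 T ∧ HasCompactSupport ρ ∧
      ContDiff ℝ ((⊤ : ℕ∞) : WithTop ℕ∞) ρ ∧ ∫ t, ρ t = 1 := by
    let f : ContDiffBump (T / 2) := ⟨T / 8, T / 4, by positivity, by linarith⟩
    refine ⟨f.normed volume, ?_, f.hasCompactSupport_normed, f.contDiff_normed,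
      f.integral_normed⟩
    rw [f.tsupport_normed_eq, Real.closedBall_eq_Icc]
    refine Set.Icc_subset_Ioo ?_ ?_
    · change 0 < T / 2 - T / 4; linarith
    · change T / 2 + T / 4 < T; linarith
  set c := ∫ t in Set.Ioo 0 T, ρ t • y t with hc
  refine ⟨c, ?_⟩
  have hint : ∀ ψ : ℝ → ℝ, ContDiff ℝ ((⊤ : ℕ∞) : WithTop ℕ∞) ψ → HasCompactSupport ψ →
      Integrable (fun t => ψ t • y t) (timeMeasure T) := by
    intro ψ h1 h2
    obtain ⟨C, hC⟩ := h2.exists_bound_of_continuous h1.continuous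
    exact hy.bdd_smul C h1.continuous.aestronglyMeasurable (Eventually.of_forall hC)
  have key : ∀ᵐ t ∂(volume : Measure ℝ), t ∈ Set.Ioo 0 T → y t - c = 0 := by
    refine isOpen_Ioo.ae_eq_zero_of_integral_contDiff_smul_eq_zero ?_ ?_
    · exact (IntegrableOn.locallyIntegrableOn (f := fun t => y t - c)
        (hy.sub (integrable_const c)))
    intro ψ hψd hψc hψs
    have hψ0 : ∫ t, ψ t • (y t - c) = ∫ t in Set.Ioo 0 T, ψ t • (y t - c) := by
      refine (setIntegral_eq_integral_of_forall_compl_eq_zero fun t ht => ?_).symm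
      rw [image_eq_zero_of_notMem_tsupport fun h => ht (hψs h), zero_smul]
    have hψI : ∫ t in Set.Ioo 0 T, ψ t = ∫ t, ψ t :=
      setIntegral_eq_integral_of_forall_compl_eq_zero fun t ht =>
        image_eq_zero_of_notMem_tsupport fun h => ht (hψs h)
    have hψi : Integrable ψ := hψd.continuous.integrable_of_hasCompactSupport hψc
    have hρi : Integrable ρ := hρd.continuous.integrable_of_hasCompactSupport hρc
    -- `ψ - r * ρ` has mean zero, so it is the derivative of a test function and the hypothesis
    -- applies to it.
    set r := ∫ t, ψ t with hr
    have hsub : tsupport (fun t => ψ t - r * ρ t) ⊆ tsupport ψ ∪ tsupport ρ := by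
      refine closure_minimal (fun t ht => ?_) ((isClosed_tsupport _).union (isClosed_tsupport _))
      by_contra hcon
      rw [Set.mem_union, not_or] at hcon
      apply ht
      simp [image_eq_zero_of_notMem_tsupport hcon.1, image_eq_zero_of_notMem_tsupport hcon.2]
    have hχd : ContDiff ℝ ((⊤ : ℕ∞) : WithTop ℕ∞) (fun t => ψ t - r * ρ t) :=
      hψd.sub (contDiff_const.mul hρd)
    obtain ⟨φ, h1, h2, h3, h4⟩ := exists_deriv_eq (T := T) hχd
      (HasCompactSupport.of_support_subset_isCompact (hψc.isCompact.union hρc.isCompact)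
        ((subset_tsupport _).trans hsub))
      (hsub.trans (Set.union_subset hψs hρs)) (by
        rw [integral_sub hψi (hρi.const_mul r), integral_const_mul, hρ1, mul_one, sub_self])
    have h5 := h φ h1 h2 h3
    rw [h4] at h5
    have h6 : ∫ t in Set.Ioo 0 T, (ψ t - r * ρ t) • y t
        = (∫ t in Set.Ioo 0 T, ψ t • y t) - r • c := by
      have h7 : Integrable (fun t => r • ρ t • y t) (timeMeasure T) := (hint ρ hρd hρc).smul r
      rw [hc, ← integral_smul, ← integral_sub (hint ψ hψd hψc) h7]
      simp only [sub_smul, mul_smul]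
    rw [h6] at h5
    rw [hψ0]
    simp only [smul_sub]
    rw [integral_sub (hint ψ hψd hψc) (hψi.integrableOn.smul_const c), integral_smul_const, hψI]
    exact h5
  rw [ae_restrict_iff' measurableSet_Ioo]
  filter_upwards [key] with t ht h
  exact sub_eq_zero.1 (ht h)

theorem integrable_L2 {T : ℝ} {n : ℕ} (v : L2 T n) : Integrable v (timeMeasure T) :=
  (Lp.memLp v).integrable one_le_two

/-- The embedding of `L²(0,T)` into `L¹(0,T)`. -/
theorem exists_integral_norm_le (T : ℝ) :
    ∃ C : ℝ, 0 ≤ C ∧ ∀ (n : ℕ) (v : L2 T n), ∫ s in Set.Ioo 0 T, ‖v s‖ ≤ C * ‖v‖ := by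
  refine ⟨(timeMeasure T Set.univ ^ (1 / (1 : ENNReal).toReal - 1 / (2 : ENNReal).toReal)).toReal,
    ENNReal.toReal_nonneg, fun n v => ?_⟩
  have h1 := eLpNorm_le_eLpNorm_mul_rpow_measure_univ (μ := timeMeasure T) (f := v)
    (p := 1) (q := 2) one_le_two (Lp.aestronglyMeasurable v)
  have hfin : timeMeasure T Set.univ ^ (1 / (1 : ENNReal).toReal - 1 / (2 : ENNReal).toReal) ≠ ⊤ :=
    ENNReal.rpow_ne_top_of_nonneg (by norm_num) (measure_ne_top _ _)
  have h2 := ENNReal.toReal_mono (ENNReal.mul_ne_top (Lp.eLpNorm_ne_top v) hfin) h1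
  rw [ENNReal.toReal_mul, ← Lp.norm_def, eLpNorm_one_eq_lintegral_enorm,
    ← integral_norm_eq_lintegral_enorm (Lp.aestronglyMeasurable v)] at h2
  rw [mul_comm]
  exact h2

theorem memLp_of_continuous {T : ℝ} {E : Type*} [NormedAddCommGroup E] {c : ℝ → E}
    (hc : Continuous c) : MemLp c 2 (timeMeasure T) := by
  obtain ⟨C, hC⟩ := (isCompact_Icc (a := 0) (b := T)).exists_bound_of_continuousOn hc.continuousOn
  refine MemLp.of_bound (hc.stronglyMeasurable.aestronglyMeasurable) C ?_
  rw [ae_restrict_iff' measurableSet_Ioo]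
  exact Eventually.of_forall fun t ht => hC t ⟨ht.1.le, ht.2.le⟩

theorem continuous_prim_L2 {T : ℝ} {n : ℕ} (v : L2 T n) : Continuous (prim T v) :=
  continuous_prim (integrable_L2 v)

theorem prim_L2_add {T : ℝ} {n : ℕ} (v w : L2 T n) (t : ℝ) :
    prim T (v + w : L2 T n) t = prim T v t + prim T w t := by
  rw [prim_congr_ae (Lp.coeFn_add v w), prim_add (integrable_L2 v) (integrable_L2 w)]

theorem prim_L2_smul {T : ℝ} {n : ℕ} (c : ℝ) (v : L2 T n) (t : ℝ) :
    prim T (c • v : L2 T n) t = c • prim T v t := by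
  rw [prim_congr_ae (Lp.coeFn_smul c v), prim_smul]

/-- The integration operator on `L²(0,T)`. -/
theorem exists_volterra (T : ℝ) (n : ℕ) :
    ∃ V : L2 T n →L[ℝ] L2 T n, ∀ v, V v =ᵐ[timeMeasure T] prim T v := by
  obtain ⟨C, hC0, hC⟩ := exists_integral_norm_le T
  have hae : ∀ v : L2 T n, (memLp_of_continuous (continuous_prim_L2 v)).toLp _
      =ᵐ[timeMeasure T] prim T v := fun v => MemLp.coeFn_toLp _
  let V : L2 T n →ₗ[ℝ] L2 T n :=
    { toFun := fun v => (memLp_of_continuous (continuous_prim_L2 v)).toLp _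
      map_add' := fun v w => by
        refine Lp.ext ?_
        filter_upwards [hae (v + w), hae v, hae w, Lp.coeFn_add
          ((memLp_of_continuous (continuous_prim_L2 v)).toLp _)
          ((memLp_of_continuous (T := T) (continuous_prim_L2 w)).toLp _)] with t h1 h2 h3 h4
        rw [h1, h4, Pi.add_apply, h2, h3, prim_L2_add]
      map_smul' := fun c v => by
        refine Lp.ext ?_
        filter_upwards [hae (c • v), hae v, Lp.coeFn_smul c
          ((memLp_of_continuous (T := T) (continuous_prim_L2 v)).toLp _)] with t h1 h2 h3
        rw [h1, RingHom.id_apply, h3, Pi.smul_apply, h2, prim_L2_smul] }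
  refine ⟨V.mkContinuous ((measureUnivNNReal (timeMeasure T) : ℝ) ^ (2 : ENNReal).toReal⁻¹ * C) fun v => ?_, hae⟩
  have h := Lp.norm_le_of_ae_bound (f := V v) (C := C * ‖v‖) (by positivity) ?_
  · refine h.trans (le_of_eq ?_)
    rw [mul_assoc]
  · filter_upwards [hae v, ae_restrict_mem measurableSet_Ioo] with t h1 h2
    change ‖((memLp_of_continuous (T := T) (continuous_prim_L2 v)).toLp _ : L2 T n) t‖ ≤ _
    rw [h1]
    exact (norm_prim_le (integrable_L2 v) h2.1.le).trans (hC n v)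

/-- Integration over `(0,T)` as a functional on `L²(0,T)`. -/
theorem exists_primEnd {T : ℝ} (hT : 0 ≤ T) (n : ℕ) :
    ∃ L : L2 T n →L[ℝ] Vec n, ∀ v, L v = prim T v T := by
  obtain ⟨C, hC0, hC⟩ := exists_integral_norm_le T
  let L : L2 T n →ₗ[ℝ] Vec n :=
    { toFun := fun v => prim T v T
      map_add' := fun v w => prim_L2_add v w T
      map_smul' := fun c v => prim_L2_smul c v T }
  exact ⟨L.mkContinuous C fun v => (norm_prim_le (integrable_L2 v) hT).trans (hC n v), fun v => rfl⟩

theorem integrable_test_smul {T : ℝ} {E : Type*} [NormedAddCommGroup E] [NormedSpace ℝ E]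
    {y : ℝ → E} (hy : Integrable y (timeMeasure T)) {ψ : ℝ → ℝ} (h1 : Continuous ψ)
    (h2 : HasCompactSupport ψ) : Integrable (fun t => ψ t • y t) (timeMeasure T) := by
  obtain ⟨C, hC⟩ := h2.exists_bound_of_continuous h1
  exact hy.bdd_smul C h1.aestronglyMeasurable (Eventually.of_forall hC)

/-- Elements of `H¹(0,T)` are primitives of their weak derivatives. -/
theorem H1.exists_fn_eq {T : ℝ} {n : ℕ} (hT : 0 < T) (x : H1 T n) :
    ∃ c : Vec n, ∀ᵐ t ∂(timeMeasure T), x.fn t = c + prim T x.dot t := by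
  have hp : Integrable (prim T x.dot) (timeMeasure T) :=
    (memLp_of_continuous (continuous_prim_L2 x.dot)).integrable one_le_two
  obtain ⟨c, hc⟩ := exists_ae_eq_const hT ((integrable_L2 x.fn).sub hp) fun φ h1 h2 h3 => by
    have hd : Continuous (deriv φ) := h1.continuous_deriv (by simp)
    have h4 := x.isWeakDeriv φ h1 h2 h3
    rw [← integral_deriv_smul_prim (integrable_L2 x.dot) h1 h2 h3] at h4
    simp only [Pi.sub_apply, smul_sub]
    rw [integral_sub (integrable_test_smul (integrable_L2 x.fn) hd h2.deriv)
      (integrable_test_smul hp hd h2.deriv), h4, sub_self]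
  refine ⟨c, hc.mono fun t ht => ?_⟩
  rw [← ht, Pi.sub_apply, sub_add_cancel]

theorem H1.eval_eq_add_prim {T : ℝ} {n : ℕ} (hT : 0 < T) (x : H1 T n) {c : Vec n}
    (hc : ∀ᵐ t ∂(timeMeasure T), x.fn t = c + prim T x.dot t) {t : ℝ} (ht : t ∈ Set.Icc 0 T) :
    x.eval t = c + prim T x.dot t :=
  x.eval_eq hT (c := fun t => c + prim T x.dot t)
    ⟨(continuous_const.add (continuous_prim_L2 x.dot)).continuousOn, hc⟩ ht

theorem H1.fn_ae_eq {T : ℝ} {n : ℕ} (hT : 0 < T) (x : H1 T n) :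
    ∀ᵐ t ∂(timeMeasure T), x.fn t = x.eval 0 + prim T x.dot t := by
  obtain ⟨c, hc⟩ := x.exists_fn_eq hT
  have := x.eval_eq_add_prim hT hc (t := 0) ⟨le_rfl, hT.le⟩
  rw [prim_zero, add_zero] at this
  rwa [this]

theorem H1.eval_end {T : ℝ} {n : ℕ} (hT : 0 < T) (x : H1 T n) :
    x.eval T = x.eval 0 + prim T x.dot T :=
  x.eval_eq_add_prim hT (x.fn_ae_eq hT) ⟨hT.le, le_rfl⟩

/-- A function that is a primitive of `v ∈ L²(0,T)` lies in `H¹(0,T)`, with weak derivative `v`. -/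
theorem exists_H1 {T : ℝ} {n : ℕ} (hT : 0 < T) {x v : L2 T n} {c : Vec n}
    (hx : ∀ᵐ t ∂(timeMeasure T), x t = c + prim T v t) :
    ∃ y : H1 T n, y.fn = x ∧ y.dot = v ∧ y.eval 0 = c ∧ y.eval T = c + prim T v T := by
  have hw : IsWeakDeriv x v := by
    intro φ h1 h2 h3
    have hp : Integrable (prim T v) (timeMeasure T) :=
      (memLp_of_continuous (continuous_prim_L2 v)).integrable one_le_two
    have hd : Continuous (deriv φ) := h1.continuous_deriv (by simp)
    rw [← integral_deriv_smul_prim (integrable_L2 v) h1 h2 h3,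
      integral_congr_ae (hx.mono fun t ht => by rw [ht, smul_add]),
      integral_add (integrable_test_smul (integrable_const c) hd h2.deriv)
        (integrable_test_smul hp hd h2.deriv), integral_deriv_smul_const hT h1 h3, zero_add]
  refine ⟨⟨x, v, hw⟩, rfl, rfl, ?_, ?_⟩
  · rw [H1.eval_eq_add_prim hT ⟨x, v, hw⟩ hx ⟨le_rfl, hT.le⟩, prim_zero, add_zero]
  · exact H1.eval_eq_add_prim hT ⟨x, v, hw⟩ hx ⟨hT.le, le_rfl⟩

/-! ### Controllability -/

theorem prim_eq_integral {E : Type*} [NormedAddCommGroup E] [NormedSpace ℝ E] {T : ℝ} (v : ℝ → E)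
    {t : ℝ} (ht : t ∈ Set.Icc 0 T) : prim T v t = ∫ s in (0 : ℝ)..t, v s := by
  rw [prim, intervalIntegral.integral_of_le ht.1, intervalIntegral.integral_of_le ht.1,
    integral_Ioc_eq_integral_Ioo, integral_Ioc_eq_integral_Ioo]
  refine setIntegral_congr_fun measurableSet_Ioo fun s hs => ?_
  have hs' : s ∈ Set.Ioo 0 T := ⟨hs.1, hs.2.trans_le ht.2⟩
  exact Set.indicator_of_mem hs' v

section Semigroup

variable {E : Type*} [NormedAddCommGroup E] [NormedSpace ℝ E] [CompleteSpace E]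

theorem exp_smul_mul_exp_neg_smul (A : E →L[ℝ] E) (t : ℝ) :
    NormedSpace.exp (t • A) * NormedSpace.exp ((-t) • A) = 1 := by
  let _ : NormedAlgebra ℚ (E →L[ℝ] E) := NormedAlgebra.restrictScalars ℚ ℝ (E →L[ℝ] E)
  rw [← NormedSpace.exp_add_of_commute
    (((Commute.refl A).smul_left t).smul_right (-t)), ← add_smul]
  simp

theorem continuous_exp_smul (A : E →L[ℝ] E) :
    Continuous fun t : ℝ => NormedSpace.exp (t • A) :=
  continuous_iff_continuousAt.2 fun t => (hasDerivAt_exp_smul_const (𝕂 := ℝ) A t).continuousAt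

/-- Variation of constants. -/
theorem hasDerivAt_variation_of_constants (A : E →L[ℝ] E) (y₀ : E) {f : ℝ → E}
    (hf : Continuous f) (t : ℝ) :
    HasDerivAt (fun t => NormedSpace.exp (t • A)
        (y₀ + ∫ s in (0 : ℝ)..t, NormedSpace.exp ((-s) • A) (f s)))
      (A (NormedSpace.exp (t • A)
        (y₀ + ∫ s in (0 : ℝ)..t, NormedSpace.exp ((-s) • A) (f s))) + f t) t := by
  have hc : Continuous fun s : ℝ => NormedSpace.exp ((-s) • A) (f s) :=
    ((continuous_exp_smul A).comp continuous_neg).clm_apply hf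
  have h1 : HasDerivAt (fun t : ℝ => y₀ + ∫ s in (0 : ℝ)..t, NormedSpace.exp ((-s) • A) (f s))
      (NormedSpace.exp ((-t) • A) (f t)) t :=
    (intervalIntegral.integral_hasDerivAt_right (hc.intervalIntegrable _ _)
      (hc.stronglyMeasurableAtFilter _ _) hc.continuousAt).const_add y₀
  have h2 := (hasDerivAt_exp_smul_const' (𝕂 := ℝ) A t).clm_apply h1
  have h3 : NormedSpace.exp (t • A) (NormedSpace.exp ((-t) • A) (f t)) = f t := by
    have := congrArg (fun L : E →L[ℝ] E => L (f t)) (exp_smul_mul_exp_neg_smul A t)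
    simpa using this
  rw [h3] at h2
  exact h2

end Semigroup

section Kalman

open scoped InnerProductSpace

variable {E W : Type*} [NormedAddCommGroup E] [InnerProductSpace ℝ E] [FiniteDimensional ℝ E]
  [NormedAddCommGroup W] [InnerProductSpace ℝ W]

/-- An observed trajectory of the adjoint system that vanishes on an interval is zero. -/
theorem eq_zero_of_inner_exp_eq_zero (A : E →L[ℝ] E) (G : W →L[ℝ] E)
    (hAG : ∀ η : E, (∀ (k : ℕ) (w : W), ⟪η, (A ^ k) (G w)⟫_ℝ = 0) → η = 0) {T : ℝ} (hT : 0 < T)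
    {η : E} (hη : ∀ s ∈ Set.Icc 0 T, ∀ w, ⟪η, NormedSpace.exp ((-s) • A) (G w)⟫_ℝ = 0) :
    η = 0 := by
  -- Differentiating in `s` brings down one more factor `A`. Two-sided derivatives need the open
  -- interval; `s → 0⁺` then recovers the Kalman condition.
  have hexp : ∀ k : ℕ, ∀ s ∈ Set.Ioo 0 T, ∀ w,
      ⟪η, NormedSpace.exp ((-s) • A) ((A ^ k) (G w))⟫_ℝ = 0 := by
    intro k
    induction k with
    | zero => intro s hs w; simpa using hη s ⟨hs.1.le, hs.2.le⟩ w
    | succ k ih =>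
      intro s hs w
      have h1 : HasDerivAt (fun s : ℝ => ⟪η, NormedSpace.exp ((-s) • A) ((A ^ k) (G w))⟫_ℝ)
          (⟪η, (-(NormedSpace.exp ((-s) • A) * A)) ((A ^ k) (G w))⟫_ℝ) s := by
        have h2 := (hasDerivAt_exp_smul_const (𝕂 := ℝ) A (-s)).scomp s (hasDerivAt_neg s)
        have h3 := h2.clm_apply (hasDerivAt_const s ((A ^ k) (G w)))
        have h4 := (hasDerivAt_const s η).inner ℝ h3
        simpa using h4
      have h2 : (fun s : ℝ => ⟪η, NormedSpace.exp ((-s) • A) ((A ^ k) (G w))⟫_ℝ) =ᶠ[𝓝 s]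
          fun _ => 0 := by
        filter_upwards [isOpen_Ioo.mem_nhds hs] with r hr using ih r hr w
      have h3 := h1.unique ((hasDerivAt_const s (0 : ℝ)).congr_of_eventuallyEq h2)
      simpa [pow_succ'] using h3
  refine hAG η fun k w => ?_
  have hc : Continuous fun s : ℝ => ⟪η, NormedSpace.exp ((-s) • A) ((A ^ k) (G w))⟫_ℝ :=
    continuous_const.inner (((continuous_exp_smul A).comp continuous_neg).clm_apply
      continuous_const)
  have h1 : Tendsto (fun s : ℝ => ⟪η, NormedSpace.exp ((-s) • A) ((A ^ k) (G w))⟫_ℝ) (𝓝[>] 0)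
      (𝓝 ⟪η, (A ^ k) (G w)⟫_ℝ) := by
    simpa using (hc.tendsto 0).mono_left nhdsWithin_le_nhds
  refine tendsto_nhds_unique h1 (tendsto_const_nhds.congr' ?_)
  filter_upwards [Ioo_mem_nhdsGT hT] with s hs using (hexp k s hs w).symm

variable [FiniteDimensional ℝ W]

/-- Surjectivity of the controllability map. -/
theorem exists_control_integral_eq (A : E →L[ℝ] E) (G : W →L[ℝ] E)
    (hAG : ∀ η : E, (∀ (k : ℕ) (w : W), ⟪η, (A ^ k) (G w)⟫_ℝ = 0) → η = 0) {T : ℝ} (hT : 0 < T)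
    (z : E) : ∃ w : ℝ → W, Continuous w ∧
      ∫ s in (0 : ℝ)..T, NormedSpace.exp ((-s) • A) (G (w s)) = z := by
  have : CompleteSpace E := FiniteDimensional.complete ℝ E
  have : CompleteSpace W := FiniteDimensional.complete ℝ W
  -- With the adjoint output as control, `η ↦ ∫ exp(-sA) G w` is the controllability Gramian, and
  -- `⟪η, L η⟫ = ∫ ‖w η‖²`. Injectivity gives surjectivity in finite dimension.
  set w : E → ℝ → W := fun η s => ContinuousLinearMap.adjoint G
    (ContinuousLinearMap.adjoint (NormedSpace.exp ((-s) • A)) η) with hw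
  have hwc : ∀ η, Continuous (w η) := fun η =>
    (ContinuousLinearMap.adjoint G).continuous.comp
      ((ContinuousLinearMap.adjoint.continuous.comp
        ((continuous_exp_smul A).comp continuous_neg)).clm_apply continuous_const)
  have hcont : ∀ η, Continuous fun s => NormedSpace.exp ((-s) • A) (G (w η s)) := fun η =>
    ((continuous_exp_smul A).comp continuous_neg).clm_apply (G.continuous.comp (hwc η))
  let L : E →ₗ[ℝ] E :=
    { toFun := fun η => ∫ s in (0 : ℝ)..T, NormedSpace.exp ((-s) • A) (G (w η s))
      map_add' := fun η η' => by
        rw [← intervalIntegral.integral_add ((hcont η).intervalIntegrable _ _)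
          ((hcont η').intervalIntegrable _ _)]
        simp [hw]
      map_smul' := fun c η => by
        rw [RingHom.id_apply, ← intervalIntegral.integral_smul]
        simp [hw] }
  have hinj : Function.Injective L := by
    refine (injective_iff_map_eq_zero L).2 fun η hη => ?_
    have h1 : ∫ s in (0 : ℝ)..T, ‖w η s‖ ^ 2 = 0 := by
      have h2 : ⟪η, ∫ s in (0 : ℝ)..T, NormedSpace.exp ((-s) • A) (G (w η s))⟫_ℝ = 0 := by
        have : (∫ s in (0 : ℝ)..T, NormedSpace.exp ((-s) • A) (G (w η s))) = 0 := hη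
        rw [this, inner_zero_right]
      have h3 := (innerSL ℝ η).intervalIntegral_comp_comm (μ := volume)
        ((hcont η).intervalIntegrable 0 T)
      simp only [innerSL_apply_apply] at h3
      rw [← h3] at h2
      rw [← h2]
      congr 1
      ext s
      rw [← ContinuousLinearMap.adjoint_inner_left, ← ContinuousLinearMap.adjoint_inner_left,
        real_inner_self_eq_norm_sq]
    have hsq : Continuous fun s => ‖w η s‖ ^ 2 := (hwc η).norm.pow 2
    refine eq_zero_of_inner_exp_eq_zero A G hAG hT fun s hs y => ?_
    have h4 : ‖w η s‖ ^ 2 = 0 := by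
      by_contra hne
      have : 0 < ∫ s in (0 : ℝ)..T, ‖w η s‖ ^ 2 :=
        intervalIntegral.integral_pos hT hsq.continuousOn (fun _ _ => sq_nonneg _)
          ⟨s, hs, lt_of_le_of_ne (sq_nonneg _) (Ne.symm hne)⟩
      exact this.ne' h1
    have h5 : w η s = 0 := by simpa using h4
    rw [← ContinuousLinearMap.adjoint_inner_left, ← ContinuousLinearMap.adjoint_inner_left]
    change ⟪w η s, y⟫_ℝ = 0
    rw [h5, inner_zero_left]
  obtain ⟨η, hη⟩ := (LinearMap.injective_iff_surjective.1 hinj) z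
  exact ⟨w η, hwc η, hη⟩

/-- A controllable system with a square integrable forcing term can be steered to any target. -/
theorem exists_trajectory (A : E →L[ℝ] E) (G : W →L[ℝ] E)
    (hAG : ∀ η : E, (∀ (k : ℕ) (w : W), ⟪η, (A ^ k) (G w)⟫_ℝ = 0) → η = 0) {T : ℝ} (hT : 0 < T)
    {h : ℝ → E} (hh : Integrable h (timeMeasure T)) (x₀ b : E) :
    ∃ (x : ℝ → E) (w : ℝ → W), Continuous x ∧ Continuous w ∧ x T = b ∧
      ∀ t ∈ Set.Icc 0 T, x t = x₀ + prim T (fun s => A (x s) + h s + G (w s)) t := by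
  have : CompleteSpace E := FiniteDimensional.complete ℝ E
  -- Since `h` is merely integrable, its primitive is split off: `y = x - prim T h` solves an
  -- equation with the continuous forcing `f`, to which variation of constants applies.
  have hH := continuous_prim hh
  have hAH : Continuous fun s => A (prim T h s) := A.continuous.comp hH
  have hS : Continuous fun s : ℝ => NormedSpace.exp ((-s) • A) :=
    (continuous_exp_smul A).comp continuous_neg
  -- The target is the value of the control integral for which `y T = b - prim T h T`.
  obtain ⟨w, hwc, hw⟩ := exists_control_integral_eq A G hAG hT
    (NormedSpace.exp ((-T) • A) (b - prim T h T) - x₀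
      - ∫ s in (0 : ℝ)..T, NormedSpace.exp ((-s) • A) (A (prim T h s)))
  have hGw : Continuous fun s => G (w s) := G.continuous.comp hwc
  set f : ℝ → E := fun s => A (prim T h s) + G (w s) with hf
  have hfc : Continuous f := hAH.add hGw
  set y : ℝ → E := fun t => NormedSpace.exp (t • A)
    (x₀ + ∫ s in (0 : ℝ)..t, NormedSpace.exp ((-s) • A) (f s)) with hy
  have hyd := hasDerivAt_variation_of_constants A x₀ hfc
  have hyc : Continuous y := continuous_iff_continuousAt.2 fun t => (hyd t).continuousAt
  have hy0 : y 0 = x₀ := by simp [hy]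
  refine ⟨fun t => y t + prim T h t, w, hyc.add hH, hwc, ?_, fun t ht => ?_⟩
  · have h1 : ∫ s in (0 : ℝ)..T, NormedSpace.exp ((-s) • A) (f s) =
        NormedSpace.exp ((-T) • A) (b - prim T h T) - x₀ := by
      simp only [hf, map_add]
      rw [intervalIntegral.integral_add ((hS.clm_apply hAH).intervalIntegrable _ _)
        ((hS.clm_apply hGw).intervalIntegrable _ _), hw]
      abel
    have h2 : NormedSpace.exp (T • A) (NormedSpace.exp ((-T) • A) (b - prim T h T))
        = b - prim T h T := by
      have := congrArg (fun L : E →L[ℝ] E => L (b - prim T h T)) (exp_smul_mul_exp_neg_smul A T)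
      simpa using this
    simp only [hy]
    rw [h1, add_sub_cancel, h2, sub_add_cancel]
  · have hc : Continuous fun s => A (y s) + f s := (A.continuous.comp hyc).add hfc
    have h1 : ∫ s in (0 : ℝ)..t, (A (y s) + f s) = y t - y 0 :=
      intervalIntegral.integral_eq_sub_of_hasDerivAt (fun s _ => hyd s)
        (hc.intervalIntegrable _ _)
    have hci : Integrable (fun s => A (y s) + f s) (timeMeasure T) :=
      (memLp_of_continuous hc).integrable one_le_two
    have h2 : (fun s => A (y s + prim T h s) + h s + G (w s)) = (fun s => A (y s) + f s) + h := by
      ext s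
      simp only [hf, map_add, Pi.add_apply]
      abel
    rw [h2, prim_add hci hh, prim_eq_integral _ ht, h1, hy0, ← add_assoc, add_sub_cancel]

end Kalman

/-- The continuous linear map of a matrix between Euclidean spaces. -/
noncomputable def matCLM {a b : ℕ} (A : Matrix (Fin a) (Fin b) ℝ) : Vec b →L[ℝ] Vec a :=
  LinearMap.toContinuousLinearMap (Matrix.toLpLin 2 2 A)

theorem matCLM_ofLp {a b : ℕ} (A : Matrix (Fin a) (Fin b) ℝ) (x : Vec b) :
    (matCLM A x).ofLp = A *ᵥ x.ofLp := by
  simp [matCLM, Matrix.toLpLin_apply]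

theorem eq_zero_of_vecMul_eq_zero {a : ℕ} {ι : Type*} [Fintype ι]
    {C : Matrix (Fin a) ι ℝ} (hC : C.rank = a) {η : Fin a → ℝ} (h : η ᵥ* C = 0) : η = 0 := by
  have h1 : Module.finrank ℝ (LinearMap.range Cᵀ.mulVecLin) = a := by
    rw [← Matrix.rank_transpose] at hC
    exact hC
  have h2 := LinearMap.finrank_range_add_finrank_ker Cᵀ.mulVecLin
  rw [h1, Module.finrank_fin_fun] at h2
  have h3 : LinearMap.ker Cᵀ.mulVecLin = ⊥ := Submodule.finrank_eq_zero.1 (by omega)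
  have h4 : η ∈ LinearMap.ker Cᵀ.mulVecLin := by
    rw [LinearMap.mem_ker, Matrix.mulVecLin_apply, Matrix.mulVec_transpose, h]
  rw [h3] at h4
  simpa using h4

theorem mul_pinv {l m : ℕ} {D : Matrix (Fin l) (Fin m) ℝ} (hD : D.rank = l) : D * pinv D = 1 := by
  have hdet : (D * Dᵀ).det ≠ 0 := by
    intro h0
    obtain ⟨η, hη, h⟩ := Matrix.exists_vecMul_eq_zero_iff.2 h0
    exact hη (eq_zero_of_vecMul_eq_zero (by rw [Matrix.rank_self_mul_transpose, hD]) h)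
  rw [pinv, ← Matrix.mul_assoc, Matrix.mul_nonsing_inv _ (Ne.isUnit hdet)]

section Data

open scoped InnerProductSpace

variable {Ξ : Type*} {T : ℝ} {n m l k : ℕ}

/-- The right-hand side `A x + B u` of the dynamics. -/
noncomputable def Data.rhs (p : Data Ξ T n m l k) : (L2 T n × L2 T m) →L[ℝ] L2 T n :=
  ((matCLM p.A).compLpL 2 (timeMeasure T)).comp (ContinuousLinearMap.fst ℝ _ _) +
    ((matCLM p.B).compLpL 2 (timeMeasure T)).comp (ContinuousLinearMap.snd ℝ _ _)

theorem Data.rhs_ae (p : Data Ξ T n m l k) (z : L2 T n × L2 T m) :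
    ∀ᵐ t ∂(timeMeasure T), p.rhs z t = matCLM p.A (z.1 t) + matCLM p.B (z.2 t) := by
  filter_upwards [Lp.coeFn_add ((matCLM p.A).compLpL 2 (timeMeasure T) z.1)
    ((matCLM p.B).compLpL 2 (timeMeasure T) z.2),
    (matCLM p.A).coeFn_compLpL z.1, (matCLM p.B).coeFn_compLpL z.2] with t h1 h2 h3
  rw [← h2, ← h3]
  exact h1

/-- With `u = D†(f - C x) + Y w`, the identities `D D† = 1` and `D Y = 0` turn the path constraint
into an equality, whatever `w` is; `w` remains free to steer the controllable closed-loop system. -/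
theorem Data.exists_steering (p : Data Ξ T n m l k) (hT : 0 < T) (hp : p.ControlAssumption)
    (b : Vec n) :
    ∃ z : L2 T n × L2 T m,
      (∀ᵐ t ∂(timeMeasure T), z.1 t = p.x₀ + prim T (p.rhs z) t) ∧
      p.x₀ + prim T (p.rhs z) T = b ∧
      ∀ᵐ t ∂(timeMeasure T), matCLM p.C (z.1 t) + matCLM p.D (z.2 t) = p.f t := by
  obtain ⟨-, hD, Y, -, hDY, hrank⟩ := hp
  set A' := p.A - p.B * pinv p.D * p.C with hA'
  have hAG : ∀ η : Vec n, (∀ (j : ℕ) (w : Vec (m - l)),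
      ⟪η, (matCLM A' ^ j) (matCLM (p.B * Y) w)⟫_ℝ = 0) → η = 0 := by
    intro η hη
    have hpow : ∀ (j : ℕ) (x : Vec n), ((matCLM A' ^ j) x).ofLp = A' ^ j *ᵥ x.ofLp := by
      intro j
      induction j with
      | zero => intro x; simp
      | succ j ih =>
        intro x
        rw [pow_succ, mul_apply_eq_comp, ih, matCLM_ofLp, Matrix.mulVec_mulVec,
          ← pow_succ]
    have h0 : η.ofLp ᵥ* p.controlMatrix Y = 0 := by
      ext ⟨j, i⟩
      have h1 := hη j (EuclideanSpace.single i 1)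
      rw [real_inner_comm, EuclideanSpace.inner_eq_star_dotProduct] at h1
      simp only [hpow, matCLM_ofLp, star_trivial, Matrix.mulVec_mulVec] at h1
      simp only [Matrix.vecMul, Pi.zero_apply]
      rw [← h1]
      congr 1
      ext a
      simp only [Data.controlMatrix, Matrix.of_apply]
      rw [← hA', Matrix.mul_assoc]
      simp
    have := eq_zero_of_vecMul_eq_zero hrank h0
    exact (WithLp.ofLp_eq_zero 2).1 this
  set h : ℝ → Vec n := fun t => matCLM (p.B * pinv p.D) (p.f t) with hh
  have hhi : Integrable h (timeMeasure T) :=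
    (matCLM (p.B * pinv p.D)).integrable_comp (integrable_L2 p.f)
  obtain ⟨x, w, hx, hw, hxT, hxt⟩ :=
    exists_trajectory (matCLM A') (matCLM (p.B * Y)) hAG hT hhi p.x₀ b
  have hu : MemLp (fun t => matCLM (pinv p.D) (p.f t - matCLM p.C (x t)) + matCLM Y (w t)) 2
      (timeMeasure T) := by
    refine MemLp.add ?_ (memLp_of_continuous ((matCLM Y).continuous.comp hw))
    exact (matCLM (pinv p.D)).comp_memLp' ((Lp.memLp p.f).sub
      (memLp_of_continuous ((matCLM p.C).continuous.comp hx)))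
  have hx2 : MemLp x 2 (timeMeasure T) := memLp_of_continuous hx
  have hrhs : p.rhs (hx2.toLp _, hu.toLp _) =ᵐ[timeMeasure T]
      fun s => matCLM A' (x s) + h s + matCLM (p.B * Y) (w s) := by
    filter_upwards [p.rhs_ae (hx2.toLp _, hu.toLp _), hx2.coeFn_toLp, hu.coeFn_toLp] with t h1 h2 h3
    rw [h1, h2, h3]
    refine WithLp.ofLp_injective 2 ?_
    simp only [WithLp.ofLp_add, WithLp.ofLp_sub, matCLM_ofLp, hh, hA', Matrix.mulVec_add,
      Matrix.mulVec_sub, Matrix.mulVec_mulVec, Matrix.sub_mulVec, Matrix.mul_assoc]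
    abel
  refine ⟨(hx2.toLp _, hu.toLp _), ?_, ?_, ?_⟩
  · rw [prim_congr_ae hrhs]
    filter_upwards [hx2.coeFn_toLp, ae_restrict_mem measurableSet_Ioo] with t h1 h2
    rw [h1]
    exact hxt t ⟨h2.1.le, h2.2.le⟩
  · rw [prim_congr_ae hrhs, ← hxt T ⟨hT.le, le_rfl⟩, hxT]
  · filter_upwards [hx2.coeFn_toLp, hu.coeFn_toLp] with t h1 h2
    rw [h1, h2]
    refine WithLp.ofLp_injective 2 ?_
    simp only [WithLp.ofLp_add, WithLp.ofLp_sub, matCLM_ofLp, Matrix.mulVec_add,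
      Matrix.mulVec_sub, Matrix.mulVec_mulVec, ← Matrix.mul_assoc, mul_pinv hD, hDY,
      Matrix.one_mulVec, Matrix.one_mul, Matrix.zero_mulVec]
    abel

end Data

/-! ### Existence of minimizers -/

section Minimization

variable {X G : Type*} [NormedAddCommGroup X] [NormedSpace ℝ X] [CompleteSpace X]
  [NormedAddCommGroup G] [NormedSpace ℝ G]

/-- Sequential weak lower semicontinuity of a uniformly convex function, along a linear map. -/
theorem exists_mem_le_of_uniformlyConvex {q : X → ℝ} (hqc : Continuous q) (hq0 : ∀ z, 0 ≤ q z)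
    {σ : ℝ} (hσ : 0 < σ)
    (hmid : ∀ y z, q ((1 / 2 : ℝ) • (y + z)) + σ * ‖y - z‖ ^ 2 ≤ (q y + q z) / 2)
    {C : Set X} (hC : IsClosed C) (hCmid : ∀ y ∈ C, ∀ z ∈ C, (1 / 2 : ℝ) • (y + z) ∈ C)
    {e : X → G} (hec : Continuous e)
    (hemid : ∀ y z, e ((1 / 2 : ℝ) • (y + z)) = (1 / 2 : ℝ) • (e y + e z))
    {u : ℕ → X} (hu : ∀ i, u i ∈ C) {b : G} (hb : Tendsto (fun i => e (u i)) atTop (𝓝 b)) {ρ : ℝ}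
    (hρ : Tendsto (fun i => q (u i)) atTop (𝓝 ρ)) :
    ∃ z ∈ C, e z = b ∧ q z ≤ ρ := by
  have hbdd : ∀ S : Set X, BddBelow (q '' S) := fun S => ⟨0, by rintro _ ⟨z, -, rfl⟩; exact hq0 z⟩
  set r : ℕ → ℝ := fun k => 1 / ((k : ℝ) + 1) with hr
  have hr0 : ∀ k, 0 < r k := fun k => by simp only [hr]; positivity
  have hrlim : Tendsto r atTop (𝓝 0) := tendsto_one_div_add_atTop_nhds_zero_nat
  have hranti : ∀ j k, j ≤ k → r k ≤ r j := fun j k hjk => Nat.one_div_le_one_div hjk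
  -- The infima of `q` over these nested sets increase and stay below `ρ`. Almost-minimizers replace
  -- `u`, so weak limits are not needed.
  let S : ℕ → Set X := fun k => {z | z ∈ C ∧ ‖e z - b‖ ≤ r k}
  have hSanti : ∀ j k, j ≤ k → S k ⊆ S j := fun j k hjk z hz => ⟨hz.1, hz.2.trans (hranti j k hjk)⟩
  have hSu : ∀ k, ∀ᶠ i in atTop, u i ∈ S k := by
    intro k
    filter_upwards [Metric.tendsto_nhds.1 hb (r k) (hr0 k)] with i hi
    exact ⟨hu i, by rw [← dist_eq_norm]; exact hi.le⟩
  have hSne : ∀ k, (S k).Nonempty := fun k => (hSu k).exists.imp' u fun i hi => hi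
  set a : ℕ → ℝ := fun k => sInf (q '' S k) with ha
  have hamono : Monotone a := fun j k hjk =>
    csInf_le_csInf (hbdd _) ((hSne k).image q) (Set.image_mono (hSanti j k hjk))
  have haρ : ∀ k, a k ≤ ρ := fun k => ge_of_tendsto hρ <| by
    filter_upwards [hSu k] with i hi using csInf_le (hbdd _) ⟨u i, hi, rfl⟩
  have habdd : BddAbove (Set.range a) := ⟨ρ, by rintro _ ⟨k, rfl⟩; exact haρ k⟩
  have halim := tendsto_atTop_ciSup hamono habdd
  set α := ⨆ k, a k with hα
  have haα : ∀ k, a k ≤ α := fun k => le_ciSup habdd k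
  have hαρ : α ≤ ρ := ciSup_le haρ
  have hex : ∀ k, ∃ v ∈ S k, q v < a k + r k := by
    intro k
    obtain ⟨_, ⟨v, hv, rfl⟩, h⟩ := exists_lt_of_csInf_lt ((hSne k).image q)
      (show sInf (q '' S k) < a k + r k by have := hr0 k; simp only [ha]; linarith)
    exact ⟨v, hv, h⟩
  choose v hvS hvq using hex
  -- The midpoint of `v j` and `v k` lies in `S N`, so its value is at least `a N`; uniform
  -- convexity turns the small gap into a small distance.
  have hdist : ∀ N j k, N ≤ j → N ≤ k → ‖v j - v k‖ ^ 2 ≤ (α - a N + r N) / σ := by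
    intro N j k hj hk
    have h1 := hSanti N j hj (hvS j)
    have h2 := hSanti N k hk (hvS k)
    have hm : (1 / 2 : ℝ) • (v j + v k) ∈ S N := by
      refine ⟨hCmid _ h1.1 _ h2.1, ?_⟩
      have : e ((1 / 2 : ℝ) • (v j + v k)) - b
          = (1 / 2 : ℝ) • ((e (v j) - b) + (e (v k) - b)) := by
        rw [hemid]; module
      rw [this, norm_smul]
      have h3 := norm_add_le (e (v j) - b) (e (v k) - b)
      have h4 := h1.2
      have h5 := h2.2
      norm_num
      linarith
    have h3 : a N ≤ q ((1 / 2 : ℝ) • (v j + v k)) := csInf_le (hbdd _) ⟨_, hm, rfl⟩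
    have h4 := hmid (v j) (v k)
    rw [le_div_iff₀ hσ]
    linarith [hvq j, hvq k, haα j, haα k, hranti N j hj, hranti N k hk]
  have hcauchy : CauchySeq v := by
    refine cauchySeq_of_le_tendsto_0 (fun N => Real.sqrt ((α - a N + r N) / σ)) ?_ ?_
    · intro j k N hj hk
      rw [dist_eq_norm]
      exact Real.le_sqrt_of_sq_le (hdist N j k hj hk)
    · have h1 : Tendsto (fun N => (α - a N + r N) / σ) atTop (𝓝 ((α - α + 0) / σ)) :=
        ((tendsto_const_nhds.sub halim).add hrlim).div_const σ
      have h2 := (Real.continuous_sqrt.tendsto _).comp h1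
      simpa [Function.comp_def] using h2
  obtain ⟨z, hz⟩ := cauchySeq_tendsto_of_complete hcauchy
  refine ⟨z, hC.mem_of_tendsto hz (Eventually.of_forall fun k => (hvS k).1), ?_, ?_⟩
  · have h1 : Tendsto (fun k => e (v k)) atTop (𝓝 b) := by
      rw [tendsto_iff_norm_sub_tendsto_zero]
      exact squeeze_zero (fun _ => norm_nonneg _) (fun k => (hvS k).2) hrlim
    exact tendsto_nhds_unique ((hec.tendsto z).comp hz) h1
  · have h1 : Tendsto (fun k => a k + r k) atTop (𝓝 (α + 0)) := halim.add hrlim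
    have h2 := le_of_tendsto_of_tendsto' ((hqc.tendsto z).comp hz) h1 fun k => (hvq k).le
    linarith

/-- Existence of minimizers of `φ ∘ e + q` with `q` uniformly convex and `φ` of linear growth. -/
theorem exists_isMinOn_of_uniformlyConvex [ProperSpace G] {q : X → ℝ} (hqc : Continuous q)
    (hq0 : ∀ z, 0 ≤ q z) {σ : ℝ} (hσ : 0 < σ)
    (hmid : ∀ y z, q ((1 / 2 : ℝ) • (y + z)) + σ * ‖y - z‖ ^ 2 ≤ (q y + q z) / 2)
    {s d : ℝ} (hs : 0 < s) (hqs : ∀ z, s * ‖z‖ ^ 2 - d ≤ q z)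
    {C : Set X} (hC : IsClosed C) (hCmid : ∀ y ∈ C, ∀ z ∈ C, (1 / 2 : ℝ) • (y + z) ∈ C)
    {e : X → G} (hec : Continuous e)
    (hemid : ∀ y z, e ((1 / 2 : ℝ) • (y + z)) = (1 / 2 : ℝ) • (e y + e z))
    {c₀ c₁ : ℝ} (he : ∀ z, ‖e z‖ ≤ c₀ + c₁ * ‖z‖)
    {Γ : Set G} (hΓ : IsClosed Γ) {φ : G → ℝ} (hφ : Continuous φ) {a κ : ℝ} (hκ : 0 ≤ κ)
    (hφb : ∀ b, - a - κ * ‖b‖ ≤ φ b) (hne : ∃ z ∈ C, e z ∈ Γ) :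
    ∃ z ∈ C, e z ∈ Γ ∧ ∀ y ∈ C, e y ∈ Γ → φ (e z) + q z ≤ φ (e y) + q y := by
  set J : X → ℝ := fun z => φ (e z) + q z with hJ
  set S : Set X := {z | z ∈ C ∧ e z ∈ Γ} with hS
  -- The last term completes the square: half the quadratic growth of `q` absorbs the linear
  -- decrease of `φ ∘ e`.
  set K := a + κ * c₀ + d + (κ * c₁) ^ 2 / (2 * s) with hK
  have hlow : ∀ z, s / 2 * ‖z‖ ^ 2 - K ≤ J z := by
    intro z
    have h1 := hφb (e z)
    have h2 := mul_le_mul_of_nonneg_left (he z) hκ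
    have h3 := hqs z
    have h4 : 0 ≤ s / 2 * ‖z‖ ^ 2 - κ * c₁ * ‖z‖ + (κ * c₁) ^ 2 / (2 * s) := by
      have : s / 2 * ‖z‖ ^ 2 - κ * c₁ * ‖z‖ + (κ * c₁) ^ 2 / (2 * s)
          = s / 2 * (‖z‖ - κ * c₁ / s) ^ 2 := by field_simp; ring
      rw [this]; positivity
    simp only [hJ, hK]
    linarith
  have hbdd : BddBelow (J '' S) := ⟨- K, by
    rintro _ ⟨z, -, rfl⟩
    have := hlow z
    have : 0 ≤ s / 2 * ‖z‖ ^ 2 := by positivity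
    linarith⟩
  have hSne : (J '' S).Nonempty := by
    obtain ⟨z, h1, h2⟩ := hne
    exact ⟨_, z, ⟨h1, h2⟩, rfl⟩
  obtain ⟨y, -, hylim, hy⟩ := exists_seq_tendsto_sInf hSne hbdd
  choose u huS huJ using hy
  set i₀ := sInf (J '' S) with hi₀
  have hJlim : Tendsto (fun k => J (u k)) atTop (𝓝 i₀) := by simpa [huJ] using hylim
  obtain ⟨R, hR⟩ := hJlim.bddAbove_range
  have hub : ∀ k, e (u k) ∈ Metric.closedBall (0 : G)
      (c₀ + |c₁| * Real.sqrt ((R + K) / (s / 2))) := by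
    intro k
    rw [mem_closedBall_zero_iff]
    have h1 : J (u k) ≤ R := hR ⟨k, rfl⟩
    have h2 : ‖u k‖ ≤ Real.sqrt ((R + K) / (s / 2)) := by
      refine Real.le_sqrt_of_sq_le ?_
      rw [le_div_iff₀ (by positivity)]
      linarith [hlow (u k)]
    have h3 : c₁ * ‖u k‖ ≤ |c₁| * Real.sqrt ((R + K) / (s / 2)) :=
      mul_le_mul (le_abs_self _) h2 (norm_nonneg _) (abs_nonneg _)
    linarith [he (u k)]
  obtain ⟨b, -, ψ, hψ, hb⟩ := (isCompact_closedBall (0 : G) _).tendsto_subseq hub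
  have hbΓ : b ∈ Γ := hΓ.mem_of_tendsto hb (Eventually.of_forall fun k => (huS _).2)
  have hqlim : Tendsto (fun k => q (u (ψ k))) atTop (𝓝 (i₀ - φ b)) := by
    have h1 := (hJlim.comp hψ.tendsto_atTop).sub ((hφ.tendsto b).comp hb)
    refine h1.congr fun k => ?_
    simp [hJ]
  -- `Γ` and `φ` need no convexity: the new point has `e z = b` exactly.
  obtain ⟨z, hzC, hzb, hzq⟩ := exists_mem_le_of_uniformlyConvex hqc hq0 hσ hmid hC hCmid hec hemid
    (fun k => (huS (ψ k)).1) hb hqlim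
  refine ⟨z, hzC, hzb ▸ hbΓ, fun y hyC hyΓ => ?_⟩
  have h1 : i₀ ≤ J y := csInf_le hbdd ⟨y, ⟨hyC, hyΓ⟩, rfl⟩
  simp only [hJ] at h1
  rw [hzb]
  linarith

end Minimization

theorem norm_half_add_sq {H : Type*} [NormedAddCommGroup H] [InnerProductSpace ℝ H] (x y a : H) :
    ‖(1 / 2 : ℝ) • (x + y) - a‖ ^ 2
      = (‖x - a‖ ^ 2 + ‖y - a‖ ^ 2) / 2 - ‖x - y‖ ^ 2 / 4 := by
  have h := parallelogram_law_with_norm ℝ (x - a) (y - a)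
  have h1 : (x - a) + (y - a) = (2 : ℝ) • ((1 / 2 : ℝ) • (x + y) - a) := by module
  have h2 : (x - a) - (y - a) = x - y := by abel
  rw [h1, h2, norm_smul, Real.norm_ofNat] at h
  linarith

/-- Sets of `L²` functions with values a.e. in a closed set are closed. -/
theorem isClosed_ae_mem {T : ℝ} {n : ℕ} {S : Set (Vec n)} (hS : IsClosed S) :
    IsClosed {y : L2 T n | ∀ᵐ t ∂(timeMeasure T), y t ∈ S} := by
  refine IsSeqClosed.isClosed fun y z hy hz => ?_
  obtain ⟨ψ, -, hψ⟩ := (tendstoInMeasure_of_tendsto_Lp hz).exists_seq_tendsto_ae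
  have hall : ∀ᵐ t ∂(timeMeasure T), ∀ i, y i t ∈ S := ae_all_iff.2 hy
  filter_upwards [hψ, hall] with t h1 h2
  exact hS.mem_of_tendsto h1 (Eventually.of_forall fun i => h2 _)

section Data

variable {Ξ : Type*} {T : ℝ} {n m l k : ℕ}

/-- The path constraint residual `C x + D u - f`. -/
noncomputable def Data.pathMap (p : Data Ξ T n m l k) (z : L2 T n × L2 T m) : L2 T l :=
  (matCLM p.C).compLpL 2 (timeMeasure T) z.1 + (matCLM p.D).compLpL 2 (timeMeasure T) z.2 - p.f

theorem Data.continuous_pathMap (p : Data Ξ T n m l k) : Continuous p.pathMap := by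
  exact ((((matCLM p.C).compLpL 2 (timeMeasure T)).continuous.comp continuous_fst).add
    (((matCLM p.D).compLpL 2 (timeMeasure T)).continuous.comp continuous_snd)).sub continuous_const

theorem Data.pathMap_mid (p : Data Ξ T n m l k) (y z : L2 T n × L2 T m) :
    p.pathMap ((1 / 2 : ℝ) • (y + z)) = (1 / 2 : ℝ) • (p.pathMap y + p.pathMap z) := by
  simp only [Data.pathMap, Prod.smul_fst, Prod.smul_snd, Prod.fst_add, Prod.snd_add, map_smul,
    map_add]
  module

theorem Data.pathMap_ae (p : Data Ξ T n m l k) (z : L2 T n × L2 T m) :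
    ∀ᵐ t ∂(timeMeasure T), p.pathMap z t = matCLM p.C (z.1 t) + matCLM p.D (z.2 t) - p.f t := by
  filter_upwards [Lp.coeFn_sub ((matCLM p.C).compLpL 2 (timeMeasure T) z.1 +
      (matCLM p.D).compLpL 2 (timeMeasure T) z.2) p.f,
    Lp.coeFn_add ((matCLM p.C).compLpL 2 (timeMeasure T) z.1)
    ((matCLM p.D).compLpL 2 (timeMeasure T) z.2),
    (matCLM p.C).coeFn_compLpL z.1, (matCLM p.D).coeFn_compLpL z.2] with t h0 h1 h2 h3
  rw [← h2, ← h3]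
  unfold Data.pathMap
  rw [h0, Pi.sub_apply, h1, Pi.add_apply]

/-- Pairs that satisfy the dynamics, the initial condition and the path constraint. -/
def Data.admissible (p : Data Ξ T n m l k) : Set (L2 T n × L2 T m) :=
  {z | (∀ᵐ t ∂(timeMeasure T), z.1 t = p.x₀ + prim T (p.rhs z) t) ∧
    ∀ᵐ t ∂(timeMeasure T), p.pathMap z t ∈ {w : Vec l | ∀ i, w i ≤ 0}}

theorem isClosed_nonpos (l : ℕ) : IsClosed {w : Vec l | ∀ i, w i ≤ 0} := by
  have := isClosed_forall_nonneg (E := Vec l) (f := fun i w => - w i) fun i => by fun_prop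
  simpa using this

/-- In integrated form the dynamics and the initial condition are one continuous affine equation in
`L²`, hence closed and stable under midpoints. -/
theorem Data.exists_affine (p : Data Ξ T n m l k) :
    ∃ (L : L2 T n × L2 T m →L[ℝ] L2 T n) (c : L2 T n), ∀ z : L2 T n × L2 T m,
      (∀ᵐ t ∂(timeMeasure T), z.1 t = p.x₀ + prim T (p.rhs z) t) ↔ z.1 = c + L z := by
  obtain ⟨V, hV⟩ := exists_volterra T n
  refine ⟨V.comp p.rhs, Lp.const 2 (timeMeasure T) p.x₀, fun z => ?_⟩
  have h : ∀ᵐ t ∂(timeMeasure T), (Lp.const 2 (timeMeasure T) p.x₀ + V.comp p.rhs z : L2 T n) t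
      = p.x₀ + prim T (p.rhs z) t := by
    filter_upwards [Lp.coeFn_add (Lp.const 2 (timeMeasure T) p.x₀) (V.comp p.rhs z),
      Lp.coeFn_const 2 (timeMeasure T) p.x₀, hV (p.rhs z)] with t h1 h2 h3
    rw [h1, Pi.add_apply, h2, ← h3]
    rfl
  constructor
  · intro hz
    refine Lp.ext ?_
    filter_upwards [h, hz] with t h1 h2
    rw [h1, h2]
  · intro hz
    rw [hz] at *
    filter_upwards [h] with t h1
    rw [← h1, ← hz]

theorem Data.isClosed_admissible (p : Data Ξ T n m l k) : IsClosed p.admissible := by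
  obtain ⟨L, c, hL⟩ := p.exists_affine
  have h : {z : L2 T n × L2 T m | ∀ᵐ t ∂(timeMeasure T), z.1 t = p.x₀ + prim T (p.rhs z) t}
      = {z | z.1 = c + L z} := Set.ext hL
  have hc : IsClosed {z : L2 T n × L2 T m | z.1 = c + L z} :=
    isClosed_eq continuous_fst (by fun_prop)
  rw [← h] at hc
  exact hc.inter ((isClosed_ae_mem (isClosed_nonpos l)).preimage p.continuous_pathMap)

theorem Data.admissible_mid (p : Data Ξ T n m l k) {y z : L2 T n × L2 T m}
    (hy : y ∈ p.admissible) (hz : z ∈ p.admissible) : (1 / 2 : ℝ) • (y + z) ∈ p.admissible := by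
  obtain ⟨L, c, hL⟩ := p.exists_affine
  refine ⟨(hL _).2 ?_, ?_⟩
  · have h1 := (hL _).1 hy.1
    have h2 := (hL _).1 hz.1
    rw [Prod.smul_fst, Prod.fst_add, map_smul, map_add, h1, h2]
    module
  · rw [p.pathMap_mid]
    filter_upwards [hy.2, hz.2, Lp.coeFn_smul (1 / 2 : ℝ) (p.pathMap y + p.pathMap z),
      Lp.coeFn_add (p.pathMap y) (p.pathMap z)] with t h1 h2 h3 h4
    rw [h3, Pi.smul_apply, h4]
    intro i
    have h5 := h1 i
    have h6 := h2 i
    simp only [PiLp.smul_apply, Pi.add_apply, PiLp.add_apply, smul_eq_mul]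
    linarith

/-- The terminal state. -/
noncomputable def Data.endpoint (p : Data Ξ T n m l k) (z : L2 T n × L2 T m) : Vec n :=
  p.x₀ + prim T (p.rhs z) T

/-- The tracking cost. -/
noncomputable def Data.tracking (p : Data Ξ T n m l k) (z : L2 T n × L2 T m) : ℝ :=
  1 / 2 * ‖z.1 - p.xd‖ ^ 2 + p.δ / 2 * ‖z.2 - p.ud‖ ^ 2

theorem Data.exists_minimizer (p : Data Ξ T n m l k) (hT : 0 < T) (hδ : 0 < p.δ)
    {Γ : Set (Vec n)} (hΓ : IsClosed Γ) {φ : Vec n → ℝ} (hφ : Continuous φ) {a κ : ℝ}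
    (hκ : 0 ≤ κ) (hφb : ∀ b, - a - κ * ‖b‖ ≤ φ b)
    (hne : ∃ z ∈ p.admissible, p.endpoint z ∈ Γ) :
    ∃ z ∈ p.admissible, p.endpoint z ∈ Γ ∧ ∀ y ∈ p.admissible, p.endpoint y ∈ Γ →
      φ (p.endpoint z) + p.tracking z ≤ φ (p.endpoint y) + p.tracking y := by
  obtain ⟨L, hL⟩ := exists_primEnd hT.le n
  have hend : ∀ z, p.endpoint z = p.x₀ + L.comp p.rhs z := fun z => by
    rw [Data.endpoint, ← hL]; rfl
  have hprod : ∀ z : L2 T n × L2 T m, ‖z‖ ^ 2 ≤ ‖z.1‖ ^ 2 + ‖z.2‖ ^ 2 := by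
    intro z
    rw [Prod.norm_def]
    rcases max_choice ‖z.1‖ ‖z.2‖ with h | h <;> rw [h]
    · linarith [sq_nonneg ‖z.2‖]
    · linarith [sq_nonneg ‖z.1‖]
  have hmin : 0 < min 1 p.δ := lt_min one_pos hδ
  -- The product carries the maximum norm, whence `hprod`. The factor `1/8` is `1/2` from the cost
  -- times `1/4` from the parallelogram law; `1/4` and `d` come from `r² / 2 - t² ≤ s²` when `r ≤ s
  -- + t`.
  refine exists_isMinOn_of_uniformlyConvex (X := L2 T n × L2 T m) (q := p.tracking)
    (σ := min 1 p.δ / 8) (s := min 1 p.δ / 4) (d := ‖p.xd‖ ^ 2 / 2 + p.δ / 2 * ‖p.ud‖ ^ 2)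
    (c₀ := ‖p.x₀‖) (c₁ := ‖L.comp p.rhs‖)
    ?_ (fun z => ?_) (by positivity) (fun y z => ?_) (by positivity) (fun z => ?_)
    p.isClosed_admissible (fun y hy z hz => p.admissible_mid hy hz) ?_ (fun y z => ?_)
    (fun z => ?_) hΓ hφ hκ hφb hne
  · exact (continuous_const.mul ((continuous_fst.sub continuous_const).norm.pow 2)).add
      (continuous_const.mul ((continuous_snd.sub continuous_const).norm.pow 2))
  · unfold Data.tracking
    positivity
  · have h1 := norm_half_add_sq y.1 z.1 p.xd
    have h2 := norm_half_add_sq y.2 z.2 p.ud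
    have h3 := hprod (y - z)
    simp only [Data.tracking, Prod.smul_fst, Prod.smul_snd, Prod.fst_add, Prod.snd_add]
    rw [h1, h2]
    simp only [Prod.fst_sub, Prod.snd_sub] at h3
    nlinarith [min_le_left 1 p.δ, min_le_right 1 p.δ, sq_nonneg ‖y.1 - z.1‖,
      sq_nonneg ‖y.2 - z.2‖, mul_le_mul_of_nonneg_left h3 hmin.le,
      mul_le_mul_of_nonneg_right (min_le_left 1 p.δ) (sq_nonneg ‖y.1 - z.1‖),
      mul_le_mul_of_nonneg_right (min_le_right 1 p.δ) (sq_nonneg ‖y.2 - z.2‖)]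
  · have hsq : ∀ r s t : ℝ, 0 ≤ r → r ≤ s + t → r ^ 2 / 2 - t ^ 2 ≤ s ^ 2 := by
      intro r s t hr h
      nlinarith [sq_nonneg (s - t)]
    have h1 := hsq ‖z.1‖ ‖z.1 - p.xd‖ ‖p.xd‖ (norm_nonneg _)
      (by simpa using norm_add_le (z.1 - p.xd) p.xd)
    have h2 := hsq ‖z.2‖ ‖z.2 - p.ud‖ ‖p.ud‖ (norm_nonneg _)
      (by simpa using norm_add_le (z.2 - p.ud) p.ud)
    have h3 := mul_le_mul_of_nonneg_left (hprod z) hmin.le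
    have h4 := mul_le_mul_of_nonneg_right (min_le_left 1 p.δ) (sq_nonneg ‖z.1‖)
    have h5 := mul_le_mul_of_nonneg_right (min_le_right 1 p.δ) (sq_nonneg ‖z.2‖)
    have h6 := mul_le_mul_of_nonneg_left h2 hδ.le
    unfold Data.tracking
    linarith
  · rw [funext hend]
    fun_prop
  · simp only [hend, map_smul, map_add]
    module
  · rw [hend]
    exact (norm_add_le _ _).trans (by gcongr; exact (L.comp p.rhs).le_opNorm z)

end Data

/-! ### The sample average approximation -/

theorem continuous_sampleMean {Ξ E V : Type*} [TopologicalSpace E] [NormedAddCommGroup V]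
    [NormedSpace ℝ V] {h : E → Ξ → V} {s : ℕ → Ξ} (hc : ∀ i, Continuous fun b => h b (s i))
    (ν : ℕ) : Continuous fun b => sampleMean s ν (h b) :=
  (continuous_finsetSum _ fun i _ => hc i).const_smul _

theorem abs_sampleMean_sub_le {Ξ : Type*} {h₁ h₂ c : Ξ → ℝ} {s : ℕ → Ξ} {r : ℝ}
    (hle : ∀ i, |h₁ (s i) - h₂ (s i)| ≤ c (s i) * r) (ν : ℕ) :
    |sampleMean s ν h₁ - sampleMean s ν h₂| ≤ sampleMean s ν c * r := by
  simp only [sampleMean, smul_eq_mul]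
  rw [← mul_sub, abs_mul, ← Finset.sum_sub_distrib, mul_assoc, Finset.sum_mul,
    abs_of_nonneg (by positivity : (0 : ℝ) ≤ 1 / (ν : ℝ))]
  exact mul_le_mul_of_nonneg_left
    ((Finset.abs_sum_le_sum_abs _ _).trans (Finset.sum_le_sum fun i _ => hle i)) (by positivity)

section Data

variable {Ξ : Type*} {T : ℝ} {n m l k : ℕ}

/-- The terminal states allowed by the residual and terminal constraints. -/
def Data.terminalSet (p : Data Ξ T n m l k) (s : ℕ → Ξ) (ν : ℕ) (ε : ℝ) : Set (Vec n) :=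
  {b | ‖p.saaMin s ν b‖ ≤ ε ∧ Metric.infDist (sampleMean s ν (p.g b)) p.K ≤ ε}

theorem Data.isClosed_terminalSet (p : Data Ξ T n m l k) {s : ℕ → Ξ}
    (hg : ∀ i, Continuous fun z => p.g z (s i)) (ν : ℕ) (ε : ℝ) :
    IsClosed (p.terminalSet s ν ε) := by
  have hM : ∀ (A : Matrix (Fin n) (Fin n) ℝ) i, Continuous fun b : Vec n => (A *ᵥ b.ofLp) i :=
    fun A i => (continuous_apply i).comp
      (continuous_const.matrix_mulVec (PiLp.continuous_ofLp 2 fun _ : Fin n => ℝ))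
  have h0 : Continuous fun (b : Vec n) (i : Fin n) =>
      min (b i) (sampleMean s ν (fun y => (p.M y *ᵥ b.ofLp) i + p.q y i)) := by
    refine continuous_pi fun i => ?_
    have hb : Continuous fun b : Vec n => b i := by fun_prop
    have hs : ∀ j, Continuous fun b : Vec n => (p.M (s j) *ᵥ b.ofLp) i + p.q (s j) i :=
      fun j => (hM (p.M (s j)) i).add continuous_const
    have hc := continuous_sampleMean (V := ℝ)
      (h := fun (b : Vec n) y => (p.M y *ᵥ b.ofLp) i + p.q y i) hs ν
    exact hb.min hc
  have h1 : Continuous fun b => p.saaMin s ν b :=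
    (PiLp.continuous_toLp 2 fun _ : Fin n => ℝ).comp h0
  exact (isClosed_le h1.norm continuous_const).inter
    (isClosed_le ((Metric.continuous_infDist_pt p.K).comp (continuous_sampleMean hg ν))
      continuous_const)

theorem Data.pathMap_nonpos_iff (p : Data Ξ T n m l k) (z : L2 T n × L2 T m) :
    (∀ᵐ t ∂(timeMeasure T), p.pathMap z t ∈ {w : Vec l | ∀ i, w i ≤ 0}) ↔
      ∀ᵐ t ∂(timeMeasure T), ∀ i,
        (p.C *ᵥ (z.1 t).ofLp) i + (p.D *ᵥ (z.2 t).ofLp) i - p.f t i ≤ 0 := by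
  refine eventually_congr ((p.pathMap_ae z).mono fun t ht => ?_)
  rw [ht]
  refine forall_congr' fun i => ?_
  rw [← matCLM_ofLp, ← matCLM_ofLp]
  rfl

theorem Data.dynamics_iff (p : Data Ξ T n m l k) (v : L2 T n) (z : L2 T n × L2 T m) :
    (∀ᵐ t ∂(timeMeasure T), (v t).ofLp = p.A *ᵥ (z.1 t).ofLp + p.B *ᵥ (z.2 t).ofLp) ↔
      v = p.rhs z := by
  have h : ∀ᵐ t ∂(timeMeasure T),
      (p.rhs z t).ofLp = p.A *ᵥ (z.1 t).ofLp + p.B *ᵥ (z.2 t).ofLp := by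
    filter_upwards [p.rhs_ae z] with t ht
    rw [ht, WithLp.ofLp_add, matCLM_ofLp, matCLM_ofLp]
  constructor
  · intro hv
    refine Lp.ext ?_
    filter_upwards [h, hv] with t h1 h2
    exact WithLp.ofLp_injective 2 (h2.trans h1.symm)
  · rintro rfl
    exact h

/-- Together with `Data.exists_feasible_of_admissible`, this moves the minimization from `H¹ × L²`
to a closed subset of the Banach space `L² × L²`. -/
theorem Data.IsSAAFeasible.reduce {p : Data Ξ T n m l k} (hT : 0 < T) {s : ℕ → Ξ} {ν : ℕ} {ε : ℝ}
    {z : H1 T n × L2 T m} (hz : p.IsSAAFeasible s ν ε z) :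
    (z.1.fn, z.2) ∈ p.admissible ∧ z.1.eval T = p.endpoint (z.1.fn, z.2) ∧
      p.endpoint (z.1.fn, z.2) ∈ p.terminalSet s ν ε := by
  have hdot : z.1.dot = p.rhs (z.1.fn, z.2) := (p.dynamics_iff _ _).1 hz.dynamics
  have hend : z.1.eval T = p.endpoint (z.1.fn, z.2) := by
    rw [z.1.eval_end hT, hz.initial, hdot, Data.endpoint]
  refine ⟨⟨?_, (p.pathMap_nonpos_iff _).2 hz.path⟩, hend, ?_⟩
  · have := z.1.fn_ae_eq hT
    rwa [hz.initial, hdot] at this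
  · rw [← hend]
    exact ⟨hz.residual, hz.terminal⟩

theorem Data.exists_feasible_of_admissible {p : Data Ξ T n m l k} (hT : 0 < T) {s : ℕ → Ξ} {ν : ℕ}
    {ε : ℝ} {z : L2 T n × L2 T m} (hz : z ∈ p.admissible)
    (hzε : p.endpoint z ∈ p.terminalSet s ν ε) :
    ∃ x : H1 T n, x.fn = z.1 ∧ x.eval T = p.endpoint z ∧ p.IsSAAFeasible s ν ε (x, z.2) := by
  obtain ⟨x, hx, hdot, hx0, hxT⟩ := exists_H1 hT hz.1
  have hxT' : x.eval T = p.endpoint z := hxT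
  have hpair : (x.fn, z.2) = z := by rw [hx]
  refine ⟨x, hx, hxT', ⟨?_, ?_, ?_, hx0, ?_⟩⟩
  · exact (p.dynamics_iff x.dot (x.fn, z.2)).2 (by rw [hpair, hdot])
  · exact (p.pathMap_nonpos_iff (x.fn, z.2)).1 (by rw [hpair]; exact hz.2)
  · rw [hxT']; exact hzε.1
  · rw [hxT']; exact hzε.2

/-- For continuous data of linear growth, a reachable terminal state gives an optimal solution. -/
theorem Data.exists_isSAAOptimal (p : Data Ξ T n m l k) (hT : 0 < T) (hδ : 0 < p.δ)
    (hcontrol : p.ControlAssumption) {s : ℕ → Ξ}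
    (hF : ∀ i, Continuous fun z => p.F z (s i)) (hg : ∀ i, Continuous fun z => p.g z (s i))
    {κ : Ξ → ℝ} (hκ : ∀ y, 0 ≤ κ y)
    (hFκ : ∀ i z, |p.F z (s i) - p.F 0 (s i)| ≤ κ (s i) * ‖z‖)
    {ν : ℕ} {ε : ℝ} (hne : (p.terminalSet s ν ε).Nonempty) :
    ∃ z, p.IsSAAOptimal s ν ε z := by
  obtain ⟨b, hb⟩ := hne
  obtain ⟨z₀, h1, h2, h3⟩ := p.exists_steering hT hcontrol b
  have hz₀ : z₀ ∈ p.admissible := by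
    refine ⟨h1, ?_⟩
    filter_upwards [h3, p.pathMap_ae z₀] with t h4 h5
    rw [h5, h4, sub_self]
    exact fun i => le_rfl
  obtain ⟨z, hz, hzε, hzmin⟩ := p.exists_minimizer hT hδ (p.isClosed_terminalSet hg ν ε)
    (φ := fun b => sampleMean s ν (p.F b)) (continuous_sampleMean hF ν)
    (a := |sampleMean s ν (p.F 0)|) (κ := sampleMean s ν κ)
    (smul_nonneg (by positivity) (Finset.sum_nonneg fun i _ => hκ _))
    (fun b => by
      have h4 := abs_sampleMean_sub_le (h₁ := p.F b) (h₂ := p.F 0) (c := κ) (r := ‖b‖)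
        (fun i => hFκ i b) ν
      have h5 := abs_le.1 h4
      have h6 := neg_abs_le (sampleMean s ν (p.F 0))
      linarith [h5.1])
    ⟨z₀, hz₀, by rw [Data.endpoint, h2]; exact hb⟩
  obtain ⟨x, hx, hxT, hfeas⟩ := Data.exists_feasible_of_admissible hT hz hzε
  refine ⟨(x, z.2), hfeas, fun z' hz' => ?_⟩
  obtain ⟨h4, h5, h6⟩ := hz'.reduce hT
  have h7 := hzmin _ h4 h6
  simp only [Data.tracking] at h7
  simp only [Data.saaObjective, hxT, h5, hx]
  simp only [← add_assoc] at h7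
  exact h7

end Data

/-! ### Almost sure convergence of sample averages -/

section Probability

variable {Ω Ω' Ξ : Type*} [MeasurableSpace Ω] [MeasurableSpace Ω'] [MeasurableSpace Ξ]
  {P : Measure Ω} {P' : Measure Ω'}
  {X : Ω → Ξ} {sample : ℕ → Ω' → Ξ}

/-- The strong law of large numbers for sample averages. -/
theorem ae_tendsto_sampleMean (hindep : iIndepFun sample P')
    (hident : ∀ i, IdentDistrib (sample i) X P' P) {V : Type*} [NormedAddCommGroup V]
    [NormedSpace ℝ V] [CompleteSpace V] [MeasurableSpace V] [BorelSpace V]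
    {h : Ξ → V} (hm : Measurable h) (hint : Integrable (fun ω => h (X ω)) P) :
    ∀ᵐ ω ∂P', Tendsto (fun ν => sampleMean (fun i => sample i ω) ν h) atTop
      (𝓝 (∫ ω, h (X ω) ∂P)) := by
  have hid : ∀ i, IdentDistrib (fun ω => h (sample i ω)) (fun ω => h (X ω)) P' P :=
    fun i => (hident i).comp hm
  have hlaw := strong_law_ae (fun i ω => h (sample i ω)) ((hid 0).integrable_iff.2 hint)
    (fun i j hij => (hindep.indepFun hij).comp hm hm) fun i => (hid i).trans (hid 0).symm
  rw [(hid 0).integral_eq] at hlaw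
  filter_upwards [hlaw] with ω hω
  simpa only [sampleMean, one_div] using hω

theorem ae_forall_sample (hident : ∀ i, IdentDistrib (sample i) X P' P) {Q : Ξ → Prop}
    (hQ : ∀ᵐ y ∂(P.map X), Q y) : ∀ᵐ ω ∂P', ∀ i, Q (sample i ω) := by
  refine ae_all_iff.2 fun i => ae_of_ae_map (hident i).aemeasurable_fst ?_
  rwa [(hident i).map_eq]

end Probability

theorem norm_le_vecOneNorm {n : ℕ} (b : Vec n) : ‖b‖ ≤ ∑ i, |b i| := by
  rw [EuclideanSpace.norm_eq]
  refine Real.sqrt_le_iff.2 ⟨Finset.sum_nonneg fun _ _ => abs_nonneg _, ?_⟩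
  rw [sq, Finset.sum_mul]
  refine Finset.sum_le_sum fun i _ => ?_
  rw [sq, Real.norm_eq_abs]
  exact mul_le_mul_of_nonneg_left (Finset.single_le_sum (f := fun i => |b i|)
    (fun _ _ => abs_nonneg _) (Finset.mem_univ i)) (abs_nonneg _)

theorem abs_apply_le_matNorm {n : ℕ} (A : Matrix (Fin n) (Fin n) ℝ) (i j : Fin n) :
    |A i j| ≤ matNorm A := by
  refine Real.abs_le_sqrt ?_
  calc A i j ^ 2 ≤ ∑ j, A i j ^ 2 :=
        Finset.single_le_sum (f := fun j => A i j ^ 2) (fun _ _ => sq_nonneg _) (Finset.mem_univ j)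
    _ ≤ ∑ i, ∑ j, A i j ^ 2 :=
        Finset.single_le_sum (f := fun i => ∑ j, A i j ^ 2)
          (fun _ _ => Finset.sum_nonneg fun _ _ => sq_nonneg _) (Finset.mem_univ i)

/-! ### Expectations under the growth bounds -/

section Mean

variable {Ω Ξ : Type*} [MeasurableSpace Ω] [MeasurableSpace Ξ] {P : Measure Ω}
  {X : Ω → Ξ} {T : ℝ} {n m l k : ℕ} {p : Data Ξ T n m l k}
  {κ₁ κ₂ κ₃ κ₄ : Ξ → ℝ}

theorem Data.GrowthAssumption.integrable_M (hp : p.IsStandard X P)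
    (hgr : p.GrowthAssumption X P κ₁ κ₂ κ₃ κ₄) (hX : AEMeasurable X P) (i j : Fin n) :
    Integrable (fun ω => p.M (X ω) i j) P :=
  hgr.integrable.2.2.1.mono' ((hp.M_measurable i j).comp_aemeasurable hX).aestronglyMeasurable
    (Eventually.of_forall fun _ => (abs_apply_le_matNorm _ i j).trans (hgr.M_bound _))

theorem Data.GrowthAssumption.integrable_q (hp : p.IsStandard X P)
    (hgr : p.GrowthAssumption X P κ₁ κ₂ κ₃ κ₄) (hX : AEMeasurable X P) :
    Integrable (fun ω => p.q (X ω)) P :=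
  hgr.integrable.2.2.2.mono' (hp.q_measurable.comp_aemeasurable hX).aestronglyMeasurable
    (Eventually.of_forall fun _ => hgr.q_bound _)

theorem Data.GrowthAssumption.integrable_affine (hp : p.IsStandard X P)
    (hgr : p.GrowthAssumption X P κ₁ κ₂ κ₃ κ₄) (hX : AEMeasurable X P) (b : Vec n) (i : Fin n) :
    Integrable (fun ω => (p.M (X ω) *ᵥ b.ofLp) i + p.q (X ω) i) P ∧
      ∫ ω, ((p.M (X ω) *ᵥ b.ofLp) i + p.q (X ω) i) ∂P
        = (p.meanM X P *ᵥ b.ofLp) i + (p.meanq X P).ofLp i := by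
  have hM := fun j => (hgr.integrable_M hp hX i j).mul_const (b j)
  have hMs : Integrable (fun ω => (p.M (X ω) *ᵥ b.ofLp) i) P := by
    simp only [Matrix.mulVec, dotProduct]
    exact integrable_finsetSum _ fun j _ => hM j
  have hq : Integrable (fun ω => p.q (X ω) i) P :=
    (EuclideanSpace.proj (𝕜 := ℝ) i).integrable_comp (hgr.integrable_q hp hX)
  refine ⟨hMs.add hq, ?_⟩
  rw [integral_add hMs hq]
  congr 1
  · simp only [Matrix.mulVec, dotProduct]
    rw [integral_finsetSum _ fun j _ => hM j]
    refine Finset.sum_congr rfl fun j _ => ?_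
    rw [integral_mul_const]
    rfl
  · exact (EuclideanSpace.proj (𝕜 := ℝ) i).integral_comp_comm (hgr.integrable_q hp hX)

theorem Data.GrowthAssumption.integrable_g (hp : p.IsStandard X P)
    (hgr : p.GrowthAssumption X P κ₁ κ₂ κ₃ κ₄) (hX : AEMeasurable X P) (b : Vec n) :
    Integrable (fun ω => p.g b (X ω)) P ∧
      ‖∫ ω, p.g b (X ω) ∂P‖ ≤ (∫ ω, κ₂ (X ω) ∂P) * ‖b‖ := by
  have hb := ae_of_ae_map hX (hgr.g_growth b)
  have hi := hgr.integrable.2.1.mul_const ‖b‖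
  refine ⟨hi.mono' ((hp.g_measurable b).comp_aemeasurable hX).aestronglyMeasurable hb, ?_⟩
  rw [← integral_mul_const]
  exact norm_integral_le_of_norm_le hi hb

end Mean

/-! ### Regularity of the sample and feasibility of a fixed terminal state -/

section Main

variable {Ω Ω' Ξ : Type*} [MeasurableSpace Ω] [MeasurableSpace Ω'] [MeasurableSpace Ξ]
  {P : Measure Ω} {P' : Measure Ω'}
  {X : Ω → Ξ} {sample : ℕ → Ω' → Ξ} {T : ℝ} {n m l k : ℕ} {p : Data Ξ T n m l k}
  {κ₁ κ₂ κ₃ κ₄ : Ξ → ℝ}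

/-- Almost surely, the sampled objective and constraint functions are continuous, and the objective
has linear growth. -/
theorem Data.GrowthAssumption.ae_regular (hp : p.IsStandard X P)
    (hgr : p.GrowthAssumption X P κ₁ κ₂ κ₃ κ₄) :
    ∀ᵐ y ∂(P.map X), (Continuous fun z => p.F z y) ∧ (Continuous fun z => p.g z y) ∧
      ∀ z, |p.F z y - p.F 0 y| ≤ κ₁ y * ‖z‖ := by
  -- The exceptional null set in the Lipschitz hypothesis depends on the points; a countable dense
  -- set and continuity give one null set for all `z`.
  have hd : ∀ᵐ y ∂(P.map X), ∀ i : ℕ, |p.F (TopologicalSpace.denseSeq (Vec n) i) y - p.F 0 y|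
      ≤ κ₁ y * ‖TopologicalSpace.denseSeq (Vec n) i‖ :=
    ae_all_iff.2 fun i => by simpa using hgr.F_lipschitz (TopologicalSpace.denseSeq (Vec n) i) 0
  filter_upwards [hp.F_contDiff, hp.g_contDiff, hd] with y h1 h2 h3
  refine ⟨h1.continuous, h2.continuous, fun z => ?_⟩
  exact (TopologicalSpace.denseRange_denseSeq (Vec n)).induction_on z
    (isClosed_le (h1.continuous.sub continuous_const).abs (continuous_const.mul continuous_norm)) h3

/-- A solution of the expected complementarity problem is eventually feasible for the relaxed
sample average approximation. -/
theorem Data.GrowthAssumption.ae_mem_terminalSet (hp : p.IsStandard X P)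
    (hgr : p.GrowthAssumption X P κ₁ κ₂ κ₃ κ₄) (hX : AEMeasurable X P)
    (hindep : iIndepFun sample P') (hident : ∀ i, IdentDistrib (sample i) X P' P)
    {b : Vec n} (hb : IsLCPSolution (p.meanM X P) (p.meanq X P).ofLp b.ofLp)
    (hbK : ∫ ω, p.g b (X ω) ∂P ∈ p.K) {ε : ℝ} (hε : 0 < ε) :
    ∀ᵐ ω ∂P', ∀ᶠ ν in atTop, b ∈ p.terminalSet (fun i => sample i ω) ν ε := by
  have hlcp : ∀ i, ∀ᵐ ω ∂P', Tendsto (fun ν => sampleMean (fun j => sample j ω) ν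
      (fun y => (p.M y *ᵥ b.ofLp) i + p.q y i)) atTop
      (𝓝 ((p.meanM X P *ᵥ b.ofLp) i + (p.meanq X P).ofLp i)) := by
    intro i
    obtain ⟨h1, h2⟩ := hgr.integrable_affine hp hX b i
    rw [← h2]
    refine ae_tendsto_sampleMean hindep hident (h := fun y => (p.M y *ᵥ b.ofLp) i + p.q y i) ?_ h1
    have h3 : Measurable fun y => (p.M y *ᵥ b.ofLp) i := by
      simp only [Matrix.mulVec, dotProduct]
      exact Finset.measurable_fun_sum _ fun j _ => (hp.M_measurable i j).mul_const _
    have h4 : Measurable fun y => p.q y i :=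
      (EuclideanSpace.proj (𝕜 := ℝ) i).continuous.measurable.comp hp.q_measurable
    exact h3.add h4
  have hg := ae_tendsto_sampleMean hindep hident (hp.g_measurable b) (hgr.integrable_g hp hX b).1
  filter_upwards [ae_all_iff.2 hlcp, hg] with ω h1 h2
  have h3 : Tendsto (fun ν => p.saaMin (fun i => sample i ω) ν b) atTop (𝓝 0) := by
    have h4 : Tendsto (fun ν i => min (b i) (sampleMean (fun j => sample j ω) ν
        (fun y => (p.M y *ᵥ b.ofLp) i + p.q y i))) atTop (𝓝 (0 : Fin n → ℝ)) := by
      refine tendsto_pi_nhds.2 fun i => ?_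
      have h5 := (tendsto_const_nhds (x := b i)).min (h1 i)
      -- Complementarity says exactly that the limiting residual is zero.
      have h6 : min (b i) ((p.meanM X P *ᵥ b.ofLp) i + (p.meanq X P).ofLp i) = 0 := by
        rcases mul_eq_zero.1 (hb.compl i) with h | h
        · rw [h]; exact min_eq_left (hb.slack_nonneg i)
        · rw [h]; exact min_eq_right (hb.nonneg i)
      rw [h6] at h5
      exact h5
    exact ((PiLp.continuous_toLp 2 _).tendsto _).comp h4
  have h4 := ((Metric.continuous_infDist_pt p.K).tendsto _).comp h2
  rw [Metric.infDist_zero_of_mem hbK] at h4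
  have h5 := h3.norm
  rw [norm_zero] at h5
  filter_upwards [h4.eventually (gt_mem_nhds hε), h5.eventually (gt_mem_nhds hε)] with ν h6 h7
  exact ⟨h7.le, h6.le⟩

end Main

end SAAControl

theorem theorem3p1
    {Ω Ω' : Type*} [MeasurableSpace Ω] [MeasurableSpace Ω']
    (P : Measure Ω) [IsProbabilityMeasure P] (P' : Measure Ω') [IsProbabilityMeasure P']
    {T : ℝ} {d n m l k : ℕ}
    -- the random variable, with `Ξ = ξ(Ω)`
    (ξ : Ω → SAAControl.Vec d) (hξ : Measurable ξ)
    (p : SAAControl.Data (Set.range ξ) T n m l k)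
    (hp : p.IsStandard (Set.rangeFactorization ξ) P)
    (κ₁ κ₂ κ₃ κ₄ : Set.range ξ → ℝ)
    (hgrowth : p.GrowthAssumption (Set.rangeFactorization ξ) P κ₁ κ₂ κ₃ κ₄)
    (hcontrol : p.ControlAssumption)
    (hK : Metric.closedBall (0 : SAAControl.Vec k)
      (SAAControl.beta (p.meanM (Set.rangeFactorization ξ) P)
        * (∫ ω, κ₂ (Set.rangeFactorization ξ ω) ∂P)
        * SAAControl.vecOneNorm (p.meanq (Set.rangeFactorization ξ) P)) ⊆ p.K)
    (hV : (p.feasibleLCP (Set.rangeFactorization ξ) P).Nonempty)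
    (hM : SAAControl.IsAdequate (p.meanM (Set.rangeFactorization ξ) P) ∨
      SAAControl.IsZMatrix (p.meanM (Set.rangeFactorization ξ) P))
    -- the i.i.d. sample of the random variable
    (sample : ℕ → Ω' → Set.range ξ)
    (hindep : iIndepFun sample P')
    (hident : ∀ i, IdentDistrib (sample i) (Set.rangeFactorization ξ) P' P)
    (ε : ℝ) (hε : 0 < ε) :
    ∀ᵐ ω ∂P', ∃ N : ℕ, ∀ ν : ℕ, N ≤ ν →
      ∃ z : SAAControl.H1 T n × SAAControl.L2 T m,
        p.IsSAAOptimal (fun i => sample i ω) ν ε z := by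
  have hX : AEMeasurable (Set.rangeFactorization ξ) P := (hξ.subtype_mk).aemeasurable
  obtain ⟨v, hv, hv0⟩ := hV
  obtain ⟨b, hb, hbβ⟩ := SAAControl.exists_lcp_solution_le hM
    (q := (p.meanq (Set.rangeFactorization ξ) P).ofLp) (v := v.ofLp) hv0
    fun i => (hgrowth.integrable_affine hp hX v i).2 ▸ hv i
  -- `‖𝔼 g(b)‖ ≤ 𝔼 κ₂ * ‖b‖ ≤ 𝔼 κ₂ * ‖b‖₁`, and the bound on `‖b‖₁` gives precisely the radius of
  -- the ball contained in `K`.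
  have hbK : ∫ ω, p.g (WithLp.toLp 2 b) (Set.rangeFactorization ξ ω) ∂P ∈ p.K := by
    refine hK (mem_closedBall_zero_iff.2 ?_)
    refine (hgrowth.integrable_g hp hX (WithLp.toLp 2 b)).2.trans ?_
    have h1 : ‖(WithLp.toLp 2 b : SAAControl.Vec n)‖ ≤ ∑ i, |b i| := SAAControl.norm_le_vecOneNorm _
    have h2 : 0 ≤ ∫ ω, κ₂ (Set.rangeFactorization ξ ω) ∂P :=
      integral_nonneg fun ω => (hgrowth.nonneg _).2.1
    refine (mul_le_mul_of_nonneg_left (h1.trans hbβ) h2).trans (le_of_eq ?_)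
    rw [SAAControl.vecOneNorm]
    ring
  filter_upwards [hgrowth.ae_mem_terminalSet hp hX hindep hident (b := WithLp.toLp 2 b) hb hbK hε,
    SAAControl.ae_forall_sample hident (hgrowth.ae_regular hp)] with ω h1 h2
  obtain ⟨N, hN⟩ := eventually_atTop.1 h1
  exact ⟨N, fun ν hν => p.exists_isSAAOptimal hp.T_pos hp.δ_pos hcontrol (fun i => (h2 i).1)
    (fun i => (h2 i).2.1) (fun y => (hgrowth.nonneg y).1) (fun i => (h2 i).2.2) ⟨_, hN ν hν⟩⟩
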